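/- **Stein's formulae on the sphere.** Let $n\ge 3$, $R>0$, let $\mathbb S^{n-1}(R)=\{x\in\mathbb R^n:\|x\|_2=R\}$, and let $z\sim\mathrm{Unif}(\mathbb S^{n-1}(R))$, i.e. $z$ is a random vector in $\mathbb S^{n-1}(R)$ distributed as $R\zeta/\|\zeta\|_2$ with $\zeta\sim N(0,I_n)$. For a smooth $h:\mathbb S^{n-1}(R)\to\mathbb R$ and $x\in\mathbb S^{n-1}(R)$ let $\nabla h(x)\in\mathbb R^n$ be the Euclidean gradient at $x$ of $y\mapsto h(Ry/\|y\|_2)$. For $\alpha\in\{1,2\}$ let $W^{1,\alpha}(\mathbb S^{n-1}(R))$ be the completion of the smooth functions on $\mathbb S^{n-1}(R)$ for the norm $\|h\|_{1,\alpha}=\mathbb E[|h(z)|^\alpha]^{1/\alpha}+\mathbb E[\|\nabla h(z)\|_2^\alpha]^{1/\alpha}$, the gradient being extended by continuity. For $f=(f_1,\dots,f_n)\in W^{1,\alpha}(\mathbb S^{n-1}(R))^n$ let $\nabla f\in\mathbb R^{n\times n}$ be the matrix with columns $\nabla f_1,\dots,\nabla f_n$, and let $P_x^\perp=I_n-xx^\top/\|x\|_2^2$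 for $x\ne 0$. All expectations below are finite, and: 1. For all $f\in W^{1,1}(\mathbb S^{n-1}(R))^n$, $$\mathbb E[f(z)^\top z]=\frac{R^2}{n-1}\,\mathbb E\big[\mathrm{tr}(\nabla f(z)^\top P_z^\perp)\big].$$ 2. For all $f\in W^{1,2}(\mathbb S^{n-1}(R))^n$, $$\mathbb E\big[\|f(z)-\mathbb E[f(z)]\|_2^2\big]\le\frac{R^2}{n-2}\,\mathbb E\big[\|\nabla f(z)^\top P_z^\perp\|_F^2\big].$$ 3. For all $f\in W^{1,2}(\mathbb S^{n-1}(R))^n$, $$\mathbb E\Big[\big(nR^{-2}f(z)^\top z-\mathrm{tr}(\nabla f(z)^\top P_z^\perp)\big)^2\Big] =\frac{n}{R^2}\mathbb E[\|f(z)\|_2^2]+\frac{n}{n-2}\mathbb E\,\mathrm{tr}\big[(\nabla f(z)^\top P_z^\perp)^2\big]-\frac{2}{n-2}\mathbb E\Big[\big(\mathrm{tr}(\nabla f(z)^\top P_z^\perp)\big)^2\Big]$$ $$\le\frac{n}{R^2}\mathbb E[\|f(z)\|_2^2]+\Big(1-\frac2n\Big)^{-1}\mathbb E\big[\|\nabla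 f(z)^\top P_z^\perp\|_F^2\big].$$ -/

import Mathlib

open MeasureTheory ProbabilityTheory

open scoped ENNReal Matrix

namespace SphereStein

noncomputable section

/-- The Euclidean space `ℝⁿ`. -/
abbrev Eu (n : ℕ) : Type := EuclideanSpace ℝ (Fin n)

/-- The sphere of radius `R` centred at the origin of `ℝⁿ`, as a subtype. -/
abbrev Sph (n : ℕ) (R : ℝ) : Type := Metric.sphere (0 : Eu n) R

/-- The uniform distribution on the sphere of radius `R`: the law of `R ζ / ‖ζ‖` with `ζ` a
standard Gaussian vector in `ℝⁿ`, viewed as a measure on the sphere. -/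
def unifSphere (n : ℕ) (R : ℝ) : Measure (Sph n R) :=
  ((stdGaussian (Eu n)).map (fun x => (R / ‖x‖) • x)).comap Subtype.val

open Classical in
/-- The extension `x ↦ h (R x / ‖x‖)` of a function `h` on the sphere of radius `R > 0`
to `ℝⁿ ∖ {0}`. (The value at the origin, where `R x / ‖x‖` is meaningless, is `0`.) -/
def radialExt {n : ℕ} {R : ℝ} (h : Sph n R → ℝ) (x : Eu n) : ℝ :=
  if hx : (R / ‖x‖) • x ∈ Metric.sphere (0 : Eu n) R then h ⟨(R / ‖x‖) • x, hx⟩ else 0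

/-- Infinitely differentiable functions on the sphere. -/
def SmoothOnSphere {n : ℕ} {R : ℝ} (h : Sph n R → ℝ) : Prop :=
  ContDiffOn ℝ ((⊤ : ℕ∞) : WithTop ℕ∞) (radialExt h) {0}ᶜ

/-- The gradient of a function on the sphere: the Euclidean gradient of its radial extension. -/
def sphereGrad {n : ℕ} {R : ℝ} (h : Sph n R → ℝ) (x : Sph n R) : Eu n :=
  gradient (radialExt h) (x : Eu n)

/-- The space `L^α × L^α(ℝⁿ)` over the sphere with its uniform distribution, with the norm
`‖(u, G)‖ = E[|u|^α]^{1/α} + E[‖G‖₂^α]^{1/α}`. On a pair `(h, ∇h)` it is the Sobolev norm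
of `h`. -/
abbrev LpPair (n : ℕ) (R : ℝ) (α : ℝ≥0∞) [Fact (1 ≤ α)] : Type :=
  WithLp 1 (Lp ℝ α (unifSphere n R) × Lp (Eu n) α (unifSphere n R))

/-- The pairs `(h, ∇h)` with `h` a smooth function on the sphere. -/
def smoothGraph (n : ℕ) (R : ℝ) (α : ℝ≥0∞) [Fact (1 ≤ α)] : Set (LpPair n R α) :=
  {p | ∃ h : Sph n R → ℝ, SmoothOnSphere h ∧
    p.fst =ᵐ[unifSphere n R] h ∧ p.snd =ᵐ[unifSphere n R] sphereGrad h}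

/-- The Sobolev space `W^{1,α}` of the sphere: the completion of the smooth functions for the
Sobolev norm. The map `h ↦ (h, ∇h)` is an isometry from the smooth functions with this norm into
the complete space `LpPair n R α`, so the completion is the closure of its range. An element of it
carries the function (first component) and its gradient (second component). -/
def Sobolev (n : ℕ) (R : ℝ) (α : ℝ≥0∞) [Fact (1 ≤ α)] : Set (LpPair n R α) :=
  closure (smoothGraph n R α)

variable {n : ℕ} {R : ℝ} {α : ℝ≥0∞} [Fact (1 ≤ α)]

/-- The `ℝⁿ`-valued function on the sphere given by `f = (f₁, …, fₙ)`, `fᵢ ∈ W^{1,α}`. -/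
def val (f : Fin n → Sobolev n R α) (x : Sph n R) : Eu n :=
  WithLp.toLp 2 (fun i => (f i : LpPair n R α).fst x)

/-- The gradient matrix of `f = (f₁, …, fₙ)`, with columns `∇f₁, …, ∇fₙ`. -/
def grad (f : Fin n → Sobolev n R α) (x : Sph n R) : Matrix (Fin n) (Fin n) ℝ :=
  Matrix.of (fun k i => (f i : LpPair n R α).snd x k)

/-- The projection `P_x^⊥ = I - x xᵀ / ‖x‖²`. -/
def projPerp (x : Eu n) : Matrix (Fin n) (Fin n) ℝ :=
  1 - (‖x‖ ^ 2)⁻¹ • Matrix.vecMulVec x x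

/-- The matrix `∇f(x)ᵀ P_x^⊥`. -/
def gradPerp (f : Fin n → Sobolev n R α) (x : Sph n R) : Matrix (Fin n) (Fin n) ℝ :=
  (grad f x)ᵀ * projPerp (x : Eu n)

/-- The squared Frobenius norm. -/
def frobSq (M : Matrix (Fin n) (Fin n) ℝ) : ℝ := ∑ i, ∑ j, M i j ^ 2

end

end SphereStein

/-! Every assertion is an equality, an inequality or a finiteness statement between quantities that
are continuous on the Sobolev space, so it holds on the closure of the smooth graph once it holds
for smooth functions. A smooth function is handled through its radial extension `F`, which is
homogeneous of degree 0. Euler's relation `x · ∇F = 0` says that its gradient is tangential; this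
also survives the closure, so almost everywhere `P_z^⊥` may be dropped and the gradient matrix used
directly.

Both formulae rest on one integration by parts. Orthogonal invariance makes the infinitesimal
rotation `x_j ∂_i - x_i ∂_j` integrate to zero over the sphere. Applying it to `x_j F` and summing
over `j` gives `E[R² ∂_i F - z_i (z · ∇F)] = (n - 1) E[z_i F]` for any `C¹` function `F` off the
origin (`integral_partialDeriv_unifSphere`). For degree `d` Euler's relation turns this into `R²
E[∂_i F] = (n - 1 + d) E[z_i F]`. Degree 0 is the first-order formula. For the second-order one, put
`φ = x · F` for a tuple `F = (F_i)`: the products `F_i φ` (degree 1, constant `n`) and `F_i ∂_l F_j`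
(degree -1, constant `n - 2`) give two linear relations between expectations. Antisymmetrizing the
second family cancels all second derivatives, and eliminating between the relations leaves the
identity (`integral_second_order_unifSphere`). The upper bound follows from `tr(M²) ≤ ‖M‖_F²` on
dropping a nonpositive term.

The Poincaré inequality comes from its Gaussian counterpart applied to `F(ζ)`. Since `∇F` has degree
-1, `‖∇F(ζ)‖² = (R² / ‖ζ‖²) ‖∇F(Rζ/‖ζ‖)‖²`; the two factors are independent and `E ‖ζ‖⁻² = 1 / (n -
2)`, which is where the constant and the condition `n ≥ 3` originate. The Gaussian inequality itself
is proved by interpolating between `X` and an independent copy `Y` along `cos θ X + sin θ Y`. The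
singularity of `F` at the origin is removed by a cutoff. -/

namespace SphereStein

/-! ### Gaussian density and integration by parts. -/

section Gaussian

variable {E : Type*} [NormedAddCommGroup E] [InnerProductSpace ℝ E]

/-- The density of the standard Gaussian measure with respect to the Lebesgue measure. -/
noncomputable def gaussDensity (x : E) : ℝ :=
  (2 * Real.pi) ^ (-((Module.finrank ℝ E : ℝ) / 2)) * Real.exp (-(1 / 2) * ‖x‖ ^ 2)

lemma gaussDensity_nonneg (x : E) : 0 ≤ gaussDensity x := by
  unfold gaussDensity; positivity

@[fun_prop]
lemma continuous_gaussDensity : Continuous (gaussDensity : E → ℝ) := by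
  unfold gaussDensity; fun_prop

lemma hasFDerivAt_gaussDensity (x : E) :
    HasFDerivAt (gaussDensity : E → ℝ) (-gaussDensity x • innerSL ℝ x) x := by
  have h := (((hasStrictFDerivAt_norm_sq x).hasFDerivAt.const_mul (-(1 / 2) : ℝ)).exp).const_mul
    ((2 * Real.pi) ^ (-((Module.finrank ℝ E : ℝ) / 2)))
  refine h.congr_fderiv ?_
  ext y
  simp [gaussDensity]
  ring

variable [FiniteDimensional ℝ E] [MeasurableSpace E] [BorelSpace E]

lemma integrable_gaussDensity : Integrable (gaussDensity : E → ℝ) := by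
  have h := (GaussianFourier.integrable_cexp_neg_mul_sq_norm_add (V := E) (b := (1 / 2 : ℂ)) (by norm_num) 0 0).norm
  refine (h.const_mul ((2 * Real.pi) ^ (-((Module.finrank ℝ E : ℝ) / 2)))).congr
    (Filter.Eventually.of_forall fun x => ?_)
  simp only [gaussDensity, Complex.norm_exp]
  congr 2
  simp [← Complex.ofReal_pow]

lemma integral_withDensity_gaussDensity {G : Type*} [NormedAddCommGroup G] [NormedSpace ℝ G]
    (g : E → G) :
    ∫ x, g x ∂(volume.withDensity fun x : E => ENNReal.ofReal (gaussDensity x)) =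
      ∫ x, gaussDensity x • g x := by
  rw [integral_withDensity_eq_integral_toReal_smul (by fun_prop) (by simp)]
  simp [ENNReal.toReal_ofReal (gaussDensity_nonneg _)]

/-- Both measures are finite, so it suffices to compare characteristic functions; that of the
density is an explicit Gaussian Fourier integral. -/
lemma stdGaussian_eq_withDensity :
    stdGaussian E = volume.withDensity fun x => ENNReal.ofReal (gaussDensity x) := by
  have : IsFiniteMeasure (volume.withDensity fun x : E => ENNReal.ofReal (gaussDensity x)) :=
    isFiniteMeasure_withDensity_ofReal integrable_gaussDensity.2
  refine Measure.ext_of_charFun (funext fun t => ?_)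
  rw [charFun_stdGaussian, charFun_apply, integral_withDensity_gaussDensity]
  have h := GaussianFourier.integral_cexp_neg_mul_sq_norm_add (V := E) (b := (1 / 2 : ℂ)) (by norm_num) Complex.I t
  have h2 : ∀ v : E, gaussDensity v • Complex.exp (inner ℝ v t * Complex.I) =
      (((2 * Real.pi) ^ (-((Module.finrank ℝ E : ℝ) / 2)) : ℝ) : ℂ) *
      Complex.exp (-(1 / 2) * ‖v‖ ^ 2 + Complex.I * inner ℝ t v) := by
    intro v
    rw [Complex.exp_add, gaussDensity, real_inner_comm, Complex.real_smul]
    push_cast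
    rw [mul_comm Complex.I]
    ring
  simp_rw [h2]
  rw [integral_const_mul, h, ← mul_assoc]
  have h3 : (((2 * Real.pi) ^ (-((Module.finrank ℝ E : ℝ) / 2)) : ℝ) : ℂ) *
      ((Real.pi : ℂ) / (1 / 2)) ^ ((Module.finrank ℝ E : ℂ) / 2) = 1 := by
    have h4 : ((Real.pi : ℂ) / (1 / 2)) = ((2 * Real.pi : ℝ) : ℂ) := by push_cast; ring
    have h5 : ((Module.finrank ℝ E : ℂ) / 2) = (((Module.finrank ℝ E : ℝ) / 2 : ℝ) : ℂ) := by
      push_cast; ring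
    rw [h4, h5, ← Complex.ofReal_cpow (by positivity), ← Complex.ofReal_mul,
      ← Real.rpow_add (by positivity)]
    simp
  rw [h3, one_mul, Complex.I_sq]
  congr 1
  ring

lemma integral_stdGaussian {G : Type*} [NormedAddCommGroup G] [NormedSpace ℝ G] (g : E → G) :
    ∫ x, g x ∂stdGaussian E = ∫ x, gaussDensity x • g x := by
  rw [stdGaussian_eq_withDensity, integral_withDensity_gaussDensity]

lemma lintegral_stdGaussian (g : E → ℝ≥0∞) :
    ∫⁻ x, g x ∂stdGaussian E = ∫⁻ x, ENNReal.ofReal (gaussDensity x) * g x := by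
  rw [stdGaussian_eq_withDensity, lintegral_withDensity_eq_lintegral_mul_non_measurable _
    (by fun_prop) (by simp)]
  rfl

lemma integrable_stdGaussian_iff (g : E → ℝ) :
    Integrable g (stdGaussian E) ↔ Integrable fun x => gaussDensity x * g x := by
  rw [stdGaussian_eq_withDensity, integrable_withDensity_iff_integrable_smul' (by fun_prop) (by simp)]
  simp [ENNReal.toReal_ofReal (gaussDensity_nonneg _)]

lemma stdGaussian_ae_ne_zero [Nontrivial E] : ∀ᵐ x ∂stdGaussian E, x ≠ 0 := by
  rw [stdGaussian_eq_withDensity]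
  refine (withDensity_absolutelyContinuous _ _).ae_le ?_
  exact compl_mem_ae_iff.2 (measure_singleton 0)

/-- Gaussian integration by parts. -/
lemma integral_fderiv_stdGaussian {g : E → ℝ} (hg : Differentiable ℝ g) {M K : ℝ}
    (hM : ∀ x, |g x| ≤ M) (hK : ∀ x, ‖fderiv ℝ g x‖ ≤ K) (a : E) :
    ∫ x, fderiv ℝ g x a ∂stdGaussian E = ∫ x, g x * inner ℝ x a ∂stdGaussian E := by
  have hd : ∀ x : E, fderiv ℝ gaussDensity x a = -(gaussDensity x * inner ℝ x a) := fun x => by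
    rw [(hasFDerivAt_gaussDensity x).fderiv]; simp
  have hgm := hg.continuous.aestronglyMeasurable (μ := stdGaussian E)
  have hid : Integrable (fun x : E => inner ℝ x a) (stdGaussian E) :=
    (IsGaussian.integrable_id (μ := stdGaussian E)).inner_const a
  have i1 : Integrable (fun x => g x * inner ℝ x a) (stdGaussian E) :=
    hid.bdd_mul (c := M) hgm (Filter.Eventually.of_forall hM)
  have i2 : Integrable (fun x => fderiv ℝ g x a) (stdGaussian E) :=
    Integrable.of_bound (measurable_fderiv_apply_const ℝ g a).aestronglyMeasurable (K * ‖a‖)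
      (Filter.Eventually.of_forall fun x => (ContinuousLinearMap.le_opNorm _ _).trans
        (mul_le_mul_of_nonneg_right (hK x) (norm_nonneg a)))
  have i3 : Integrable g (stdGaussian E) :=
    Integrable.of_bound hgm M (Filter.Eventually.of_forall hM)
  rw [integrable_stdGaussian_iff] at i1 i2 i3
  -- Lebesgue integration by parts moves the derivative onto the density, whose derivative along `a`
  -- is `-⟪x, a⟫` times itself.
  have h := integral_mul_fderiv_eq_neg_fderiv_mul_of_integrable (μ := (volume : Measure E))
    (f := gaussDensity) (g := g) (v := a)
    (by refine i1.neg.congr (Filter.Eventually.of_forall fun x => ?_); simp [hd]; ring)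
    i2 i3 (fun x _ => (hasFDerivAt_gaussDensity x).differentiableAt) (fun x _ => hg x)
  simp_rw [integral_stdGaussian, smul_eq_mul]
  rw [h, ← integral_neg]
  congr 1 with x
  rw [hd]; ring

end Gaussian
-- The Gaussian Poincaré inequality by interpolation.
section Poincare

variable {E : Type*} [NormedAddCommGroup E] [InnerProductSpace ℝ E] [FiniteDimensional ℝ E]
  [MeasurableSpace E] [BorelSpace E]

lemma map_rotation_stdGaussian (θ : ℝ) :
    ((stdGaussian E).prod (stdGaussian E)).map (ContinuousLinearMap.rotation θ) =
      (stdGaussian E).prod (stdGaussian E) :=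
  IsGaussian.map_rotation_eq_self integral_id_stdGaussian θ

lemma integral_comp_rotation_stdGaussian (θ : ℝ) {H : E × E → ℝ} (hH : Measurable H) :
    ∫ p, H (Real.cos θ • p.1 + Real.sin θ • p.2, -Real.sin θ • p.1 + Real.cos θ • p.2)
      ∂(stdGaussian E).prod (stdGaussian E) = ∫ p, H p ∂(stdGaussian E).prod (stdGaussian E) := by
  conv_rhs => rw [← map_rotation_stdGaussian θ]
  rw [integral_map (by fun_prop) hH.aestronglyMeasurable]
  rfl

lemma integral_comp_cos_sin_stdGaussian (θ : ℝ) {H : E → ℝ} (hH : Measurable H) :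
    ∫ p : E × E, H (Real.cos θ • p.1 + Real.sin θ • p.2)
      ∂(stdGaussian E).prod (stdGaussian E) = ∫ x, H x ∂stdGaussian E := by
  have h := integral_comp_rotation_stdGaussian θ (H := fun p : E × E => H p.1)
    (hH.comp measurable_fst)
  simpa [integral_fun_fst] using h

/-- With `U = cX + sY` and `V = -sX + cY`, the pair `(U, V)` has the law of `(X, Y)` and `X = cU -
sV`. The left side is then `E[F(cU - sV) DF(U) V]`, and Gaussian integration by parts in `V` for
fixed `U` differentiates `F(cU - sV)`, producing the factor `-s`. -/
lemma integral_fderiv_rotation_stdGaussian {F : E → ℝ} (hF : Differentiable ℝ F) {M K : ℝ}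
    (hM : ∀ x, |F x| ≤ M) (hK : ∀ x, ‖fderiv ℝ F x‖ ≤ K) (θ : ℝ) :
    ∫ p : E × E, F p.1 * fderiv ℝ F (Real.cos θ • p.1 + Real.sin θ • p.2)
        (-Real.sin θ • p.1 + Real.cos θ • p.2) ∂(stdGaussian E).prod (stdGaussian E) =
      -Real.sin θ * ∫ p : E × E, fderiv ℝ F (Real.cos θ • p.1 + -Real.sin θ • p.2)
        ((InnerProductSpace.toDual ℝ E).symm (fderiv ℝ F p.1))
        ∂(stdGaussian E).prod (stdGaussian E) := by
  have hFm : Measurable F := hF.continuous.measurable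
  have hdm : Measurable (fderiv ℝ F) := measurable_fderiv ℝ F
  set c := Real.cos θ
  set s := Real.sin θ
  have hcs : c * c + s * s = 1 := by
    have := Real.cos_sq_add_sin_sq θ
    simp only [c, s]; nlinarith
  set H : E × E → ℝ := fun p => F (c • p.1 + -s • p.2) * fderiv ℝ F p.1 p.2
  have happ : Measurable fun q : (E →L[ℝ] ℝ) × E => q.1 q.2 :=
    isBoundedBilinearMap_apply.continuous.measurable
  have hHm : Measurable H :=
    (hFm.comp (by fun_prop)).mul (happ.comp ((hdm.comp measurable_fst).prodMk measurable_snd))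
  have hHi : Integrable H ((stdGaussian E).prod (stdGaussian E)) := by
    have hid : Integrable (fun p : E × E => K * ‖p.2‖) ((stdGaussian E).prod (stdGaussian E)) :=
      (((IsGaussian.integrable_id (μ := stdGaussian E)).norm).comp_snd _).const_mul K
    refine (hid.const_mul M).mono' hHm.aestronglyMeasurable (Filter.Eventually.of_forall fun p => ?_)
    rw [norm_mul]
    exact mul_le_mul (hM _) ((ContinuousLinearMap.le_opNorm _ _).trans
      (mul_le_mul_of_nonneg_right (hK _) (norm_nonneg _))) (norm_nonneg _)
      ((abs_nonneg _).trans (hM 0))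
  set G : E × E → ℝ := fun p => fderiv ℝ F (c • p.1 + -s • p.2)
        ((InnerProductSpace.toDual ℝ E).symm (fderiv ℝ F p.1))
  have hGm : Measurable G :=
    happ.comp ((hdm.comp (by fun_prop)).prodMk
      ((LinearIsometryEquiv.continuous _).measurable.comp (hdm.comp measurable_fst)))
  have hGi : Integrable G ((stdGaussian E).prod (stdGaussian E)) := by
    refine Integrable.of_bound hGm.aestronglyMeasurable (K * K) (Filter.Eventually.of_forall fun p => ?_)
    refine (ContinuousLinearMap.le_opNorm _ _).trans (mul_le_mul (hK _) ?_ (norm_nonneg _)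
      ((norm_nonneg _).trans (hK 0)))
    simpa using hK p.1
  have h1 : ∫ p : E × E, H (c • p.1 + s • p.2, -s • p.1 + c • p.2)
      ∂(stdGaussian E).prod (stdGaussian E) = ∫ p, H p ∂(stdGaussian E).prod (stdGaussian E) :=
    integral_comp_rotation_stdGaussian θ hHm
  have h2 : ∀ p : E × E, H (c • p.1 + s • p.2, -s • p.1 + c • p.2) =
      F p.1 * fderiv ℝ F (c • p.1 + s • p.2) (-s • p.1 + c • p.2) := by
    intro p
    have : c • (c • p.1 + s • p.2) + -s • (-s • p.1 + c • p.2) = p.1 := by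
      calc _ = (c * c + s * s) • p.1 := by module
        _ = p.1 := by rw [hcs, one_smul]
    simp only [H, this]
  simp only [h2] at h1
  rw [h1, ← integral_const_mul, integral_prod _ hHi, integral_prod _ (hGi.const_mul _)]
  refine integral_congr_ae (Filter.Eventually.of_forall fun u => ?_)
  have hd : ∀ v, HasFDerivAt (fun v => F (c • u + -s • v))
      ((fderiv ℝ F (c • u + -s • v)).comp (-s • ContinuousLinearMap.id ℝ E)) v := fun v =>
    (hF _).hasFDerivAt.comp v (((hasFDerivAt_id v).const_smul (-s)).const_add (c • u))
  have h3 := integral_fderiv_stdGaussian (g := fun v => F (c • u + -s • v))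
    (fun v => (hd v).differentiableAt) (fun v => hM _) (K := K * ‖-s • ContinuousLinearMap.id ℝ E‖)
    (fun v => by
      rw [(hd v).fderiv]
      exact (ContinuousLinearMap.opNorm_comp_le _ _).trans
        (mul_le_mul_of_nonneg_right (hK _) (norm_nonneg _)))
    ((InnerProductSpace.toDual ℝ E).symm (fderiv ℝ F u))
  simp only [H, G]
  calc _ = ∫ v, F (c • u + -s • v) *
        inner ℝ v ((InnerProductSpace.toDual ℝ E).symm (fderiv ℝ F u)) ∂stdGaussian E := by
        congr 1 with v
        rw [real_inner_comm, InnerProductSpace.toDual_symm_apply]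
    _ = _ := by
        rw [← h3]
        congr 1 with v
        rw [(hd v).fderiv]
        simp [s]

/-- The Gaussian Poincaré inequality, for bounded functions with bounded derivative. -/
theorem poincare_stdGaussian {F : E → ℝ} (hF : Differentiable ℝ F) {M K : ℝ}
    (hM : ∀ x, |F x| ≤ M) (hK : ∀ x, ‖fderiv ℝ F x‖ ≤ K) :
    ∫ x, F x ^ 2 ∂stdGaussian E - (∫ x, F x ∂stdGaussian E) ^ 2 ≤
      ∫ x, ‖fderiv ℝ F x‖ ^ 2 ∂stdGaussian E := by
  have hFm : Measurable F := hF.continuous.measurable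
  have hdm : Measurable (fderiv ℝ F) := measurable_fderiv ℝ F
  have happ : Measurable fun q : (E →L[ℝ] ℝ) × E => q.1 q.2 :=
    isBoundedBilinearMap_apply.continuous.measurable
  have hM0 : 0 ≤ M := (abs_nonneg _).trans (hM 0)
  have hK0 : 0 ≤ K := (norm_nonneg _).trans (hK 0)
  set P := (stdGaussian E).prod (stdGaussian E)
  set D := ∫ x, ‖fderiv ℝ F x‖ ^ 2 ∂stdGaussian E
  -- `φ` runs from `E[F²]` at `θ = 0` to `(E F)²` at `θ = π/2`; the inequality is a lower bound `φ'
  -- ≥ -sin θ · D`, integrated.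
  set φ : ℝ → ℝ := fun θ => ∫ p : E × E, F p.1 * F (Real.cos θ • p.1 + Real.sin θ • p.2) ∂P
  set φ' : ℝ → ℝ := fun θ => ∫ p : E × E, F p.1 * fderiv ℝ F (Real.cos θ • p.1 + Real.sin θ • p.2)
        (-Real.sin θ • p.1 + Real.cos θ • p.2) ∂P
  have hφ : ∀ θ, HasDerivAt φ (φ' θ) θ := by
    intro θ
    have hid : Integrable (fun p : E × E => M * (K * (‖p.1‖ + ‖p.2‖))) P :=
      (((((IsGaussian.integrable_id (μ := stdGaussian E)).norm).comp_fst _).add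
        (((IsGaussian.integrable_id (μ := stdGaussian E)).norm).comp_snd _)).const_mul K).const_mul M
    refine (hasDerivAt_integral_of_dominated_loc_of_deriv_le (s := Set.univ) Filter.univ_mem
      (F := fun θ (p : E × E) => F p.1 * F (Real.cos θ • p.1 + Real.sin θ • p.2))
      (F' := fun θ (p : E × E) => F p.1 * fderiv ℝ F (Real.cos θ • p.1 + Real.sin θ • p.2)
        (-Real.sin θ • p.1 + Real.cos θ • p.2))
      (Filter.Eventually.of_forall fun θ => ?_) ?_ ?_ ?_ hid ?_).2
    · exact ((hFm.comp measurable_fst).mul (hFm.comp (by fun_prop))).aestronglyMeasurable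
    · refine Integrable.of_bound ((hFm.comp measurable_fst).mul
        (hFm.comp (by fun_prop))).aestronglyMeasurable (M * M) (Filter.Eventually.of_forall fun p => ?_)
      rw [norm_mul]
      exact mul_le_mul (hM _) (hM _) (norm_nonneg _) hM0
    · exact ((hFm.comp measurable_fst).mul (happ.comp
        ((hdm.comp (by fun_prop)).prodMk (by fun_prop)))).aestronglyMeasurable
    · refine Filter.Eventually.of_forall fun p t _ => ?_
      rw [norm_mul]
      refine mul_le_mul (hM _) ((ContinuousLinearMap.le_opNorm _ _).trans
        (mul_le_mul (hK _) ?_ (norm_nonneg _) hK0)) (norm_nonneg _) hM0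
      refine (norm_add_le _ _).trans (add_le_add ?_ ?_) <;> rw [norm_smul]
      · exact mul_le_of_le_one_left (norm_nonneg _) (by simpa using Real.abs_sin_le_one t)
      · exact mul_le_of_le_one_left (norm_nonneg _) (by simpa using Real.abs_cos_le_one t)
    · refine Filter.Eventually.of_forall fun p t _ => ?_
      have h := (((Real.hasDerivAt_cos t).smul_const p.1).add
        ((Real.hasDerivAt_sin t).smul_const p.2))
      exact ((hF _).hasFDerivAt.comp_hasDerivAt t h).const_mul (F p.1)
  have hφ' : ∀ θ ∈ Set.Icc 0 (Real.pi / 2), 0 ≤ φ' θ + Real.sin θ * D := by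
    intro θ hθ
    have hs : 0 ≤ Real.sin θ := Real.sin_nonneg_of_mem_Icc ⟨hθ.1, by linarith [hθ.2, Real.pi_pos]⟩
    have h1 : φ' θ = _ := integral_fderiv_rotation_stdGaussian hF hM hK θ
    have hsq : ∀ T : E × E → E, Measurable T → Integrable (fun p => ‖fderiv ℝ F (T p)‖ ^ 2) P := by
      intro T hT
      refine Integrable.of_bound ((hdm.comp hT).norm.pow_const 2).aestronglyMeasurable (K ^ 2)
        (Filter.Eventually.of_forall fun p => ?_)
      rw [Real.norm_of_nonneg (by positivity)]
      exact pow_le_pow_left₀ (norm_nonneg _) (hK _) 2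
    -- Cauchy–Schwarz followed by `ab ≤ a²/2 + b²/2`. Each of the two squares then has mean `D`,
    -- because `cos θ X - sin θ Y` is again standard Gaussian.
    have h2 : ∫ p : E × E, fderiv ℝ F (Real.cos θ • p.1 + -Real.sin θ • p.2)
        ((InnerProductSpace.toDual ℝ E).symm (fderiv ℝ F p.1)) ∂P ≤
        ∫ p : E × E, (‖fderiv ℝ F (Real.cos θ • p.1 + -Real.sin θ • p.2)‖ ^ 2 * (1 / 2)
          + ‖fderiv ℝ F p.1‖ ^ 2 * (1 / 2)) ∂P := by
      refine integral_mono ?_ (((hsq _ (by fun_prop)).mul_const _).add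
        ((hsq _ (by fun_prop)).mul_const _)) fun p => ?_
      · refine Integrable.of_bound (happ.comp ((hdm.comp (by fun_prop)).prodMk
          ((LinearIsometryEquiv.continuous _).measurable.comp
            (hdm.comp measurable_fst)))).aestronglyMeasurable (K * K)
          (Filter.Eventually.of_forall fun p => ?_)
        refine (ContinuousLinearMap.le_opNorm _ _).trans (mul_le_mul (hK _) ?_ (norm_nonneg _) hK0)
        simpa using hK p.1
      · have h := (le_abs_self _).trans (ContinuousLinearMap.le_opNorm
          (fderiv ℝ F (Real.cos θ • p.1 + -Real.sin θ • p.2))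
          ((InnerProductSpace.toDual ℝ E).symm (fderiv ℝ F p.1)))
        rw [LinearIsometryEquiv.norm_map] at h
        simp only
        nlinarith [sq_nonneg (‖fderiv ℝ F (Real.cos θ • p.1 + -Real.sin θ • p.2)‖ -
          ‖fderiv ℝ F p.1‖)]
    have h3 : ∫ p : E × E, (‖fderiv ℝ F (Real.cos θ • p.1 + -Real.sin θ • p.2)‖ ^ 2 * (1 / 2)
          + ‖fderiv ℝ F p.1‖ ^ 2 * (1 / 2)) ∂P = D := by
      rw [integral_add ((hsq _ (by fun_prop)).mul_const _) ((hsq _ (by fun_prop)).mul_const _),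
        integral_mul_const, integral_mul_const]
      have h4 := integral_comp_cos_sin_stdGaussian (-θ) (H := fun x => ‖fderiv ℝ F x‖ ^ 2)
        (hdm.norm.pow_const 2)
      have h5 : ∫ p : E × E, ‖fderiv ℝ F p.1‖ ^ 2 ∂P = D := by
        simp [P, D, integral_fun_fst (fun x => ‖fderiv ℝ F x‖ ^ 2)]
      simp only [Real.cos_neg, Real.sin_neg] at h4
      rw [h4, h5]; ring
    rw [h1]
    nlinarith [mul_le_mul_of_nonneg_left (h2.trans_eq h3) hs]
  have hmono : MonotoneOn (fun θ => φ θ - Real.cos θ * D) (Set.Icc 0 (Real.pi / 2)) := by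
    have hder : ∀ θ, HasDerivAt (fun θ => φ θ - Real.cos θ * D) (φ' θ - -Real.sin θ * D) θ := fun θ =>
      (hφ θ).sub ((Real.hasDerivAt_cos θ).mul_const D)
    refine monotoneOn_of_deriv_nonneg (convex_Icc _ _)
      (fun θ _ => (hder θ).continuousAt.continuousWithinAt)
      (fun θ _ => (hder θ).differentiableAt.differentiableWithinAt) fun θ hθ => ?_
    rw [(hder θ).deriv]
    linarith [hφ' θ (interior_subset hθ)]
  have hpi := Real.pi_pos
  have h := hmono (Set.left_mem_Icc.2 (by positivity)) (Set.right_mem_Icc.2 (by positivity))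
    (by positivity)
  have h0 : φ 0 = ∫ x, F x ^ 2 ∂stdGaussian E := by
    have := integral_fun_fst (μ := stdGaussian E) (ν := stdGaussian E) (fun x => F x ^ 2)
    simpa [φ, P, ← pow_two] using this
  have h1 : φ (Real.pi / 2) = (∫ x, F x ∂stdGaussian E) ^ 2 := by
    have := integral_prod_mul (μ := stdGaussian E) (ν := stdGaussian E) F F
    simpa [φ, P, ← pow_two] using this
  simp only [Real.cos_zero, Real.cos_pi_div_two, h0, h1] at h
  linarith

end Poincare
-- The inverse square of the Gaussian radius.
section Radial

variable {E : Type*} [NormedAddCommGroup E] [InnerProductSpace ℝ E] [FiniteDimensional ℝ E]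
  [MeasurableSpace E] [BorelSpace E]

/-- The weight turns the Gaussian density at `x` into the density at `√(1 + s) x`. Rescaling costs
`(1 + s)^(-n/2)`, with `n` the dimension, and leaves `q` unchanged by homogeneity. -/
lemma lintegral_exp_mul_stdGaussian {q : E → ℝ≥0∞} (hq : Measurable q)
    (hhom : ∀ (c : ℝ) (x : E), 0 < c → q (c • x) = q x) {s : ℝ} (hs : 0 < s) :
    ∫⁻ x, ENNReal.ofReal (Real.exp (-(s / 2) * ‖x‖ ^ 2)) * q x ∂stdGaussian E =
      ENNReal.ofReal ((1 + s) ^ (-((Module.finrank ℝ E : ℝ) / 2))) * ∫⁻ x, q x ∂stdGaussian E := by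
  have h1s : (0 : ℝ) < 1 + s := by linarith
  set r := √(1 + s)
  have hr : 0 < r := Real.sqrt_pos.2 h1s
  have hr2 : r ^ 2 = 1 + s := Real.sq_sqrt h1s.le
  set G : E → ℝ≥0∞ := fun x => ENNReal.ofReal (gaussDensity x) * q x
  have hG : Measurable G := (continuous_gaussDensity.measurable.ennreal_ofReal).mul hq
  have h1 : ∫⁻ x, G (r • x) = ENNReal.ofReal |(r ^ Module.finrank ℝ E)⁻¹| * ∫⁻ x, G x := by
    have := Measure.map_addHaar_smul (volume : Measure E) hr.ne'
    rw [← lintegral_map (μ := (volume : Measure E)) hG (measurable_const_smul r), this, lintegral_smul_measure]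
    rfl
  rw [lintegral_stdGaussian, lintegral_stdGaussian]
  have h2 : ∀ x, ENNReal.ofReal (gaussDensity x) *
      (ENNReal.ofReal (Real.exp (-(s / 2) * ‖x‖ ^ 2)) * q x) = G (r • x) := by
    intro x
    simp only [G, hhom r x hr]
    rw [← mul_assoc, ← ENNReal.ofReal_mul (gaussDensity_nonneg x)]
    congr 2
    simp only [gaussDensity]
    rw [mul_assoc, ← Real.exp_add, norm_smul, Real.norm_of_nonneg hr.le, mul_pow, hr2]
    ring_nf
  simp_rw [h2, h1]
  congr 2
  rw [abs_of_pos (by positivity), Real.rpow_neg h1s.le, ← hr2, ← Real.rpow_natCast r 2,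
    ← Real.rpow_mul hr.le, ← Real.rpow_natCast]
  congr 2
  push_cast; ring

lemma lintegral_exp_neg_mul_Ioi {a : ℝ} (ha : 0 < a) :
    ∫⁻ s in Set.Ioi (0 : ℝ), ENNReal.ofReal (1 / 2 * Real.exp (-(s / 2) * a)) =
      ENNReal.ofReal a⁻¹ := by
  have hd : ∀ s ∈ Set.Ici (0 : ℝ), HasDerivAt (fun s => -a⁻¹ * Real.exp (-(s / 2) * a))
      (1 / 2 * Real.exp (-(s / 2) * a)) s := by
    intro s _
    refine ((((((hasDerivAt_id s).div_const 2).neg.mul_const a)).exp).const_mul (-a⁻¹)).congr_deriv ?_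
    simp only [id, Pi.neg_apply]
    field_simp
  have ht : Filter.Tendsto (fun s => -a⁻¹ * Real.exp (-(s / 2) * a)) Filter.atTop (nhds 0) := by
    have : Filter.Tendsto (fun s : ℝ => -(s / 2) * a) Filter.atTop Filter.atBot := by
      have := (Filter.tendsto_id (α := ℝ) (x := Filter.atTop)).atTop_mul_const_of_neg
        (show -(a / 2) < 0 by linarith)
      refine this.congr fun s => ?_
      simp only [id]; ring
    simpa using (Real.tendsto_exp_atBot.comp this).const_mul (-a⁻¹)
  have hnn : ∀ s ∈ Set.Ioi (0 : ℝ), 0 ≤ 1 / 2 * Real.exp (-(s / 2) * a) := fun s _ => by positivity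
  rw [← ofReal_integral_eq_lintegral_ofReal
    (integrableOn_Ioi_deriv_of_nonneg' hd hnn ht)
    ((ae_restrict_iff' measurableSet_Ioi).2 (Filter.Eventually.of_forall hnn)),
    integral_Ioi_of_hasDerivAt_of_nonneg' hd hnn ht]
  simp

/-- Used with `p = n/2`, where the value is `1 / (n - 2)` and convergence `p > 1` means `n > 2`. -/
lemma lintegral_one_add_rpow_Ioi {p : ℝ} (hp : 1 < p) :
    ∫⁻ s in Set.Ioi (0 : ℝ), ENNReal.ofReal (1 / 2 * (1 + s) ^ (-p)) =
      ENNReal.ofReal (2 * p - 2)⁻¹ := by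
  have hp1 : 1 - p ≠ 0 := by linarith
  have hd : ∀ s ∈ Set.Ici (0 : ℝ), HasDerivAt (fun s => 1 / 2 * ((1 - p)⁻¹ * (1 + s) ^ (1 - p)))
      (1 / 2 * (1 + s) ^ (-p)) s := by
    intro s hs
    have hs' : (1 + s) ≠ 0 := by have : 0 ≤ s := hs; linarith
    refine (((((hasDerivAt_id s).const_add 1).rpow_const (p := 1 - p) (Or.inl hs')).const_mul
      (1 - p)⁻¹).const_mul (1 / 2)).congr_deriv ?_
    simp only [id]
    rw [show 1 - p - 1 = -p by ring]
    field_simp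
  have ht : Filter.Tendsto (fun s : ℝ => 1 / 2 * ((1 - p)⁻¹ * (1 + s) ^ (1 - p)))
      Filter.atTop (nhds 0) := by
    have h := (tendsto_rpow_neg_atTop (show 0 < p - 1 by linarith)).comp
      (Filter.tendsto_atTop_add_const_left Filter.atTop (1 : ℝ) Filter.tendsto_id)
    simpa using (h.const_mul ((1 - p)⁻¹)).const_mul (1 / 2 : ℝ)
  have hnn : ∀ s ∈ Set.Ioi (0 : ℝ), 0 ≤ 1 / 2 * (1 + s) ^ (-p) := fun s hs => by
    have : 0 < s := hs
    positivity
  rw [← ofReal_integral_eq_lintegral_ofReal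
    (integrableOn_Ioi_deriv_of_nonneg' hd hnn ht)
    ((ae_restrict_iff' measurableSet_Ioi).2 (Filter.Eventually.of_forall hnn)),
    integral_Ioi_of_hasDerivAt_of_nonneg' hd hnn ht]
  congr 1
  rw [show 2 * p - 2 = -2 * (1 - p) by ring]
  simp
  field_simp

/-- Under the standard Gaussian, `‖x‖⁻²` has mean `1 / (n - 2)` and is independent of the
direction. -/
lemma lintegral_norm_inv_sq_mul_stdGaussian (hn : 3 ≤ Module.finrank ℝ E) {q : E → ℝ≥0∞}
    (hq : Measurable q) (hhom : ∀ (c : ℝ) (x : E), 0 < c → q (c • x) = q x) :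
    ∫⁻ x, ENNReal.ofReal (‖x‖ ^ 2)⁻¹ * q x ∂stdGaussian E =
      ENNReal.ofReal ((Module.finrank ℝ E : ℝ) - 2)⁻¹ * ∫⁻ x, q x ∂stdGaussian E := by
  have : Nontrivial E := Module.nontrivial_of_finrank_pos (R := ℝ) (by omega)
  have hn' : (3 : ℝ) ≤ Module.finrank ℝ E := by exact_mod_cast hn
  -- Writing `a⁻¹ = ∫₀^∞ ½ exp(-sa/2) ds` with `a = ‖x‖²` replaces the singular weight by Gaussian
  -- weights; Tonelli then reduces the claim to the two preceding computations.
  have h1 : ∫⁻ x, ENNReal.ofReal (‖x‖ ^ 2)⁻¹ * q x ∂stdGaussian E =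
      ∫⁻ x, (∫⁻ s in Set.Ioi (0 : ℝ), ENNReal.ofReal (1 / 2 * Real.exp (-(s / 2) * ‖x‖ ^ 2)) * q x)
        ∂stdGaussian E := by
    refine lintegral_congr_ae (stdGaussian_ae_ne_zero.mono fun x hx => ?_)
    have hx' : 0 < ‖x‖ ^ 2 := by positivity
    simp only
    rw [lintegral_mul_const _ (by fun_prop), lintegral_exp_neg_mul_Ioi hx']
  rw [h1, lintegral_lintegral_swap]
  swap
  · refine Measurable.aemeasurable ?_
    have : Measurable fun p : E × ℝ => ENNReal.ofReal (1 / 2 * Real.exp (-(p.2 / 2) * ‖p.1‖ ^ 2)) := by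
      fun_prop
    exact this.mul (hq.comp measurable_fst)
  have h2 : ∫⁻ s in Set.Ioi (0 : ℝ), ∫⁻ x, ENNReal.ofReal (1 / 2 * Real.exp (-(s / 2) * ‖x‖ ^ 2)) * q x
        ∂stdGaussian E =
      ∫⁻ s in Set.Ioi (0 : ℝ), ENNReal.ofReal (1 / 2 * (1 + s) ^ (-((Module.finrank ℝ E : ℝ) / 2))) *
        ∫⁻ x, q x ∂stdGaussian E := by
    refine setLIntegral_congr_fun measurableSet_Ioi fun s hs => ?_
    have hs' : (0 : ℝ) < s := hs
    have h3 : ∀ x : E, ENNReal.ofReal (1 / 2 * Real.exp (-(s / 2) * ‖x‖ ^ 2)) * q x =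
        ENNReal.ofReal (1 / 2) * (ENNReal.ofReal (Real.exp (-(s / 2) * ‖x‖ ^ 2)) * q x) := fun x => by
      rw [ENNReal.ofReal_mul (by norm_num), mul_assoc]
    simp only [h3]
    rw [lintegral_const_mul _ (by fun_prop), lintegral_exp_mul_stdGaussian hq hhom hs', ← mul_assoc,
      ENNReal.ofReal_mul (by norm_num)]
  rw [h2, lintegral_mul_const _ (by fun_prop), lintegral_one_add_rpow_Ioi (by linarith)]
  congr 4
  ring

end Radial
-- The uniform law on the sphere and its rotation invariance.
section Sphere

variable {n : ℕ} {R : ℝ}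

lemma ne_zero_of_mem_sphere (hR : 0 < R) (z : Sph n R) : (z : Eu n) ≠ 0 :=
  ne_zero_of_norm_ne_zero (by rw [norm_eq_of_mem_sphere z]; exact hR.ne')

/-- The projection `x ↦ R x / ‖x‖` onto the sphere of radius `R`. -/
noncomputable def sphereProj (R : ℝ) (x : Eu n) : Eu n := (R / ‖x‖) • x

lemma norm_sphereProj (hR : 0 < R) {x : Eu n} (hx : x ≠ 0) : ‖sphereProj R x‖ = R := by
  have : ‖x‖ ≠ 0 := norm_ne_zero_iff.2 hx
  rw [sphereProj, norm_smul, norm_div, norm_norm, Real.norm_of_nonneg hR.le]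
  field_simp

lemma sphereProj_ne_zero (hR : 0 < R) {x : Eu n} (hx : x ≠ 0) : sphereProj R x ≠ 0 :=
  ne_zero_of_norm_ne_zero (by rw [norm_sphereProj hR hx]; exact hR.ne')

@[fun_prop]
lemma measurable_sphereProj : Measurable (sphereProj R : Eu n → Eu n) := by
  unfold sphereProj; fun_prop

lemma sphereProj_smul {c : ℝ} (hc : 0 < c) (x : Eu n) : sphereProj R (c • x) = sphereProj R x := by
  rw [sphereProj, sphereProj, norm_smul, Real.norm_of_nonneg hc.le, smul_smul]
  congr 1
  field_simp

lemma sphereProj_of_norm_eq (hR : 0 < R) {x : Eu n} (hx : ‖x‖ = R) : sphereProj R x = x := by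
  rw [sphereProj, hx, div_self hR.ne', one_smul]

lemma sphereProj_linearIsometryEquiv (U : Eu n ≃ₗᵢ[ℝ] Eu n) (x : Eu n) :
    sphereProj R (U x) = U (sphereProj R x) := by
  rw [sphereProj, sphereProj, U.norm_map, map_smul]

lemma continuous_comp_val (hR : 0 < R) {G : Type*} [TopologicalSpace G] {g : Eu n → G}
    (hg : ContinuousOn g {0}ᶜ) : Continuous fun z : Sph n R => g z :=
  hg.comp_continuous continuous_subtype_val fun z => ne_zero_of_mem_sphere hR z

lemma measurable_of_contDiffOn {F : Eu n → ℝ} (hF : ContDiffOn ℝ 1 F {0}ᶜ) : Measurable F :=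
  measurable_of_continuousOn_compl_singleton 0 hF.continuousOn

lemma continuousOn_fderiv {F : Eu n → ℝ} (hF : ContDiffOn ℝ 1 F {0}ᶜ) :
    ContinuousOn (fderiv ℝ F) {0}ᶜ :=
  hF.continuousOn_fderiv_of_isOpen isOpen_compl_singleton le_rfl

lemma hasFDerivAt_of_contDiffOn {F : Eu n → ℝ} (hF : ContDiffOn ℝ 1 F {0}ᶜ) {x : Eu n}
    (hx : x ≠ 0) : HasFDerivAt F (fderiv ℝ F x) x :=
  ((hF.differentiableOn one_ne_zero).differentiableAt
    (isOpen_compl_singleton.mem_nhds hx)).hasFDerivAt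

variable [NeZero n]

/-- Pulling back to the subtype and pushing forward restricts to the sphere. Nothing is lost, since
only the origin, a Gaussian null set, is projected off it. -/
lemma map_val_unifSphere (hR : 0 < R) :
    (unifSphere n R).map Subtype.val = (stdGaussian (Eu n)).map (sphereProj R) := by
  have hms : MeasurableSet (Metric.sphere (0 : Eu n) R) := Metric.isClosed_sphere.measurableSet
  rw [unifSphere, (MeasurableEmbedding.subtype_coe hms).map_comap, Subtype.range_coe]
  refine Measure.restrict_eq_self_of_ae_mem ?_
  change ∀ᵐ x ∂((stdGaussian (Eu n)).map (sphereProj R)), x ∈ Metric.sphere (0 : Eu n) R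
  refine (ae_map_iff measurable_sphereProj.aemeasurable hms).2 ?_
  filter_upwards [stdGaussian_ae_ne_zero (E := Eu n)] with x hx
  simpa using norm_sphereProj hR hx

lemma integral_unifSphere (hR : 0 < R) {G : Type*} [NormedAddCommGroup G] [NormedSpace ℝ G]
    {g : Eu n → G} (hg : StronglyMeasurable g) :
    ∫ z : Sph n R, g z ∂unifSphere n R = ∫ x, g (sphereProj R x) ∂stdGaussian (Eu n) := by
  have hms : MeasurableSet (Metric.sphere (0 : Eu n) R) := Metric.isClosed_sphere.measurableSet
  rw [← (MeasurableEmbedding.subtype_coe hms).integral_map, map_val_unifSphere hR,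
    integral_map (by fun_prop) hg.aestronglyMeasurable]

lemma lintegral_unifSphere (hR : 0 < R) {g : Eu n → ℝ≥0∞} (hg : Measurable g) :
    ∫⁻ z : Sph n R, g z ∂unifSphere n R = ∫⁻ x, g (sphereProj R x) ∂stdGaussian (Eu n) := by
  have hms : MeasurableSet (Metric.sphere (0 : Eu n) R) := Metric.isClosed_sphere.measurableSet
  rw [← (MeasurableEmbedding.subtype_coe hms).lintegral_map, map_val_unifSphere hR,
    lintegral_map hg (by fun_prop)]

lemma isProbabilityMeasure_unifSphere (hR : 0 < R) : IsProbabilityMeasure (unifSphere n R) := by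
  refine ⟨?_⟩
  have h := lintegral_unifSphere (n := n) hR (g := fun _ => 1) measurable_const
  simpa using h

lemma integrable_unifSphere (hR : 0 < R) {G : Type*} [NormedAddCommGroup G] {g : Eu n → G}
    (hg : ContinuousOn g {0}ᶜ) : Integrable (fun z : Sph n R => g z) (unifSphere n R) := by
  have := isProbabilityMeasure_unifSphere (n := n) hR
  exact (continuous_comp_val hR hg).integrable_of_hasCompactSupport (.of_compactSpace _)

/-- The standard Gaussian is invariant under `U`, and the radial projection commutes with `U`. -/
lemma integral_comp_linearIsometryEquiv (hR : 0 < R) (U : Eu n ≃ₗᵢ[ℝ] Eu n) {g : Eu n → ℝ}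
    (hg : Measurable g) :
    ∫ z : Sph n R, g (U z) ∂unifSphere n R = ∫ z : Sph n R, g z ∂unifSphere n R := by
  rw [integral_unifSphere hR hg.stronglyMeasurable, integral_unifSphere hR (g := fun x => g (U x))
    (hg.comp U.continuous.measurable).stronglyMeasurable]
  conv_rhs => rw [← stdGaussian_map U]
  refine Eq.trans ?_ (integral_map U.continuous.aemeasurable
    (hg.comp measurable_sphereProj).aestronglyMeasurable).symm
  simp only [Function.comp_apply, sphereProj_linearIsometryEquiv]

/-- Infinitesimal rotation invariance of the uniform distribution. -/
lemma integral_fderiv_rotation (hR : 0 < R) {F : Eu n → ℝ} (hF : ContDiffOn ℝ 1 F {0}ᶜ) {u v : Eu n}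
    (hu : ‖u‖ = 1) (hv : ‖v‖ = 1) (huv : inner ℝ u v = 0) :
    ∫ z : Sph n R, (inner ℝ u (z : Eu n) * fderiv ℝ F z v - inner ℝ v (z : Eu n) * fderiv ℝ F z u)
      ∂unifSphere n R = 0 := by
  have := isProbabilityMeasure_unifSphere (n := n) hR
  have hFm := measurable_of_contDiffOn hF
  have hFd := continuousOn_fderiv hF
  -- Reflections in the moving lines `ℝ w(t)` serve as the family of isometries. Since `ρ t`
  -- composed with `ρ 0` is a rotation by `2t` in the plane of `u` and `v`, differentiating at `t =
  -- 0` yields twice the rotation field.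
  set w : ℝ → Eu n := fun t => Real.cos t • u + Real.sin t • v
  set w' : ℝ → Eu n := fun t => -Real.sin t • u + Real.cos t • v
  have hvu : inner ℝ v u = 0 := by rw [real_inner_comm]; exact huv
  have hw : ∀ t, ‖w t‖ = 1 := fun t => by
    have : ‖w t‖ ^ 2 = 1 := by
      rw [← real_inner_self_eq_norm_sq]
      simp only [w, inner_add_left, inner_add_right, real_inner_smul_left, real_inner_smul_right,
        huv, hvu, real_inner_self_eq_norm_sq, norm_smul, mul_pow, hu, hv, Real.norm_eq_abs, sq_abs]
      nlinarith [Real.cos_sq_add_sin_sq t]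
    nlinarith [norm_nonneg (w t)]
  have hw' : ∀ t, ‖w' t‖ ≤ 2 := fun t => by
    refine (norm_add_le _ _).trans ?_
    rw [norm_smul, norm_smul, hu, hv, norm_neg]
    have h1 := Real.abs_sin_le_one t
    have h2 := Real.abs_cos_le_one t
    simp only [Real.norm_eq_abs]
    linarith
  have hwd : ∀ t, HasDerivAt w (w' t) t := fun t =>
    ((Real.hasDerivAt_cos t).smul_const u).add ((Real.hasDerivAt_sin t).smul_const v)
  set ρ : ℝ → Eu n → Eu n := fun t z => (2 * inner ℝ (w t) z) • w t - z
  have hρ : ∀ t z, (ℝ ∙ w t).reflection z = ρ t z := fun t z => by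
    rw [Submodule.reflection_singleton_apply, hw]
    simp [ρ, two_smul, two_mul, add_smul]
  have hρn : ∀ t z, ‖ρ t z‖ = ‖z‖ := fun t z => by rw [← hρ]; exact LinearIsometryEquiv.norm_map _ _
  set ρ' : ℝ → Eu n → Eu n := fun t z => (2 * inner ℝ (w t) z) • w' t + (2 * inner ℝ (w' t) z) • w t
  have hρd : ∀ z t, HasDerivAt (fun t => ρ t z) (ρ' t z) t := fun z t => by
    have h := (((hwd t).inner ℝ (hasDerivAt_const t z)).const_mul 2).smul (hwd t)
    simpa [ρ, ρ'] using h.sub_const z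
  obtain ⟨C, hC⟩ := (isCompact_sphere (0 : Eu n) R).exists_bound_of_continuousOn
    (hFd.mono fun x hx => ne_zero_of_mem_sphere hR ⟨x, hx⟩)
  have hC0 : 0 ≤ C := by
    obtain ⟨z⟩ : Nonempty (Sph n R) := (NormedSpace.sphere_nonempty.2 hR.le).to_subtype
    exact (norm_nonneg _).trans (hC z z.2)
  have hmem : ∀ t (z : Sph n R), ρ t z ∈ Metric.sphere (0 : Eu n) R := fun t z => by
    simp [hρn]
  have hcont : ∀ t, Continuous (ρ t) := fun t => by simp only [ρ]; fun_prop
  have hcont' : ∀ t, Continuous (ρ' t) := fun t => by simp only [ρ']; fun_prop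
  have hder := (hasDerivAt_integral_of_dominated_loc_of_deriv_le (μ := unifSphere n R)
    (s := Set.univ) (x₀ := (0 : ℝ)) Filter.univ_mem
    (F := fun t (z : Sph n R) => F (ρ t z)) (F' := fun t (z : Sph n R) => fderiv ℝ F (ρ t z) (ρ' t z))
    (bound := fun _ => C * (2 * R * 2 + 2 * (2 * R)))
    (Filter.Eventually.of_forall fun t =>
      (hFm.comp ((hcont t).measurable.comp measurable_subtype_coe)).aestronglyMeasurable)
    ((continuous_comp_val hR (g := fun z => F (ρ 0 z)) (hF.continuousOn.comp (hcont 0).continuousOn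
      fun x hx => by
        intro h; apply hx; have := hρn 0 x; rw [h, norm_zero] at this
        exact norm_eq_zero.1 this.symm)).integrable_of_hasCompactSupport (.of_compactSpace _))
    (Continuous.aestronglyMeasurable (by
      have h1 : Continuous fun z : Sph n R => fderiv ℝ F (ρ 0 z) :=
        hFd.comp_continuous ((hcont 0).comp continuous_subtype_val)
          fun z => ne_zero_of_mem_sphere hR ⟨_, hmem 0 z⟩
      exact h1.clm_apply ((hcont' 0).comp continuous_subtype_val)))
    (Filter.Eventually.of_forall fun z t _ => by
      have hz : ‖(z : Eu n)‖ = R := norm_eq_of_mem_sphere z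
      refine (ContinuousLinearMap.le_opNorm _ _).trans
        (mul_le_mul (hC _ (hmem t z)) ?_ (norm_nonneg _) hC0)
      have h1 : |inner ℝ (w t) (z : Eu n)| ≤ R := by
        simpa [hw, hz] using abs_real_inner_le_norm (w t) (z : Eu n)
      have h2 : |inner ℝ (w' t) (z : Eu n)| ≤ 2 * R := by
        refine (abs_real_inner_le_norm (w' t) (z : Eu n)).trans ?_
        rw [hz]; exact mul_le_mul_of_nonneg_right (hw' t) hR.le
      refine (norm_add_le _ _).trans ?_
      rw [norm_smul, norm_smul, hw, Real.norm_eq_abs, Real.norm_eq_abs, abs_mul, abs_mul, abs_two]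
      have h3 := hw' t
      nlinarith [abs_nonneg (inner ℝ (w t) (z : Eu n)), norm_nonneg (w' t)])
    (integrable_const _)
    (Filter.Eventually.of_forall fun z t _ =>
      (hasFDerivAt_of_contDiffOn hF (ne_zero_of_mem_sphere hR ⟨_, hmem t z⟩)).comp_hasDerivAt t
        (hρd z t))).2
  -- By invariance the integral does not depend on `t`, so its derivative at 0 vanishes.
  have hconst : (fun t => ∫ z : Sph n R, F (ρ t z) ∂unifSphere n R) =
      fun _ => ∫ z : Sph n R, F z ∂unifSphere n R := by
    funext t
    rw [← integral_comp_linearIsometryEquiv hR (ℝ ∙ w t).reflection hFm]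
    simp_rw [hρ]
  rw [hconst] at hder
  have h0 := hder.unique (hasDerivAt_const _ _)
  set G : Eu n → ℝ := fun x => inner ℝ u x * fderiv ℝ F x v - inner ℝ v x * fderiv ℝ F x u
  have hGm : Measurable G := by
    have h1 := measurable_fderiv_apply_const ℝ F v
    have h2 := measurable_fderiv_apply_const ℝ F u
    simp only [G]; fun_prop
  -- The velocity at `t = 0`, expressed at the reflected point `ρ 0 z`, is twice the rotation field
  -- there: the reflection fixes the `u`-coordinate and flips the `v`-coordinate. A second use of
  -- invariance then removes `ρ 0`.
  have hG : ∀ z, fderiv ℝ F (ρ 0 z) (ρ' 0 z) = 2 * G (ρ 0 z) := fun z => by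
    have e1 : inner ℝ u (ρ 0 z) = inner ℝ u z := by
      simp [ρ, w, inner_sub_right, real_inner_smul_right, hu]; ring
    have e2 : inner ℝ v (ρ 0 z) = -inner ℝ v z := by
      simp [ρ, w, inner_sub_right, real_inner_smul_right, hvu]
    simp only [G, e1, e2]
    simp [ρ', w, w']
    ring
  have h3 := integral_comp_linearIsometryEquiv hR (ℝ ∙ w 0).reflection hGm
  simp_rw [hρ] at h3
  simp_rw [hG] at h0
  rw [integral_const_mul, h3] at h0
  linarith

end Sphere
-- Integration by parts and the second-order identity on the sphere.
section IntegrationByParts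

variable {n : ℕ} {R : ℝ}

/-- The partial derivative in the `i`-th coordinate. -/
noncomputable def partialDeriv (i : Fin n) (F : Eu n → ℝ) (x : Eu n) : ℝ :=
  fderiv ℝ F x (EuclideanSpace.single i 1)

lemma continuousOn_partialDeriv {F : Eu n → ℝ} (hF : ContDiffOn ℝ 1 F {0}ᶜ) (i : Fin n) :
    ContinuousOn (partialDeriv i F) {0}ᶜ :=
  (continuousOn_fderiv hF).clm_apply continuousOn_const

lemma contDiffOn_partialDeriv {F : Eu n → ℝ} (hF : ContDiffOn ℝ 2 F {0}ᶜ) (i : Fin n) :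
    ContDiffOn ℝ 1 (partialDeriv i F) {0}ᶜ :=
  (hF.fderiv_of_isOpen isOpen_compl_singleton (by norm_num)).clm_apply contDiffOn_const

lemma sum_smul_single (x : Eu n) : ∑ j, x j • EuclideanSpace.single j (1 : ℝ) = x := by
  simpa using (EuclideanSpace.basisFun (Fin n) ℝ).sum_repr x

lemma fderiv_apply_self (F : Eu n → ℝ) (x : Eu n) :
    fderiv ℝ F x x = ∑ j, x j * partialDeriv j F x := by
  conv_lhs => rw [← sum_smul_single x, map_sum]
  rw [sum_smul_single]
  simp [partialDeriv]

lemma hasFDerivAt_coord (j : Fin n) (x : Eu n) :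
    HasFDerivAt (fun x : Eu n => x j) (EuclideanSpace.proj j : Eu n →L[ℝ] ℝ) x :=
  (EuclideanSpace.proj j : Eu n →L[ℝ] ℝ).hasFDerivAt

lemma contDiff_coord {k : WithTop ℕ∞} (j : Fin n) : ContDiff ℝ k (fun x : Eu n => x j) :=
  (EuclideanSpace.proj j : Eu n →L[ℝ] ℝ).contDiff

lemma partialDeriv_mul {F G : Eu n → ℝ} (hF : ContDiffOn ℝ 1 F {0}ᶜ) (hG : ContDiffOn ℝ 1 G {0}ᶜ)
    {x : Eu n} (hx : x ≠ 0) (i : Fin n) :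
    partialDeriv i (fun x => F x * G x) x = F x * partialDeriv i G x + partialDeriv i F x * G x := by
  have h : HasFDerivAt (fun x => F x * G x) (F x • fderiv ℝ G x + G x • fderiv ℝ F x) x :=
    (hasFDerivAt_of_contDiffOn hF hx).mul (hasFDerivAt_of_contDiffOn hG hx)
  unfold partialDeriv
  rw [h.fderiv]
  simp [mul_comm]

lemma partialDeriv_sum {ι : Type*} (s : Finset ι) {F : ι → Eu n → ℝ}
    (hF : ∀ j, ContDiffOn ℝ 1 (F j) {0}ᶜ) {x : Eu n} (hx : x ≠ 0) (i : Fin n) :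
    partialDeriv i (fun x => ∑ j ∈ s, F j x) x = ∑ j ∈ s, partialDeriv i (F j) x := by
  have h := HasFDerivAt.fun_sum (u := s) fun j _ => hasFDerivAt_of_contDiffOn (hF j) hx
  unfold partialDeriv
  rw [h.fderiv]
  simp

lemma partialDeriv_coord (i j : Fin n) (x : Eu n) :
    partialDeriv i (fun x : Eu n => x j) x = if j = i then 1 else 0 := by
  unfold partialDeriv
  rw [(hasFDerivAt_coord j x).fderiv]
  simp

lemma partialDeriv_comm {F : Eu n → ℝ} (hF : ContDiffOn ℝ 2 F {0}ᶜ) {x : Eu n} (hx : x ≠ 0)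
    (i j : Fin n) : partialDeriv i (partialDeriv j F) x = partialDeriv j (partialDeriv i F) x := by
  have hnhds := isOpen_compl_singleton.mem_nhds (show x ∈ ({0}ᶜ : Set (Eu n)) from hx)
  have hd : DifferentiableAt ℝ (fderiv ℝ F) x :=
    ((hF.fderiv_of_isOpen isOpen_compl_singleton (by norm_num)).differentiableOn
      one_ne_zero).differentiableAt hnhds
  have h : ∀ k l : Fin n, partialDeriv k (partialDeriv l F) x =
      fderiv ℝ (fderiv ℝ F) x (EuclideanSpace.single k 1) (EuclideanSpace.single l 1) := fun k l => by
    have := hd.hasFDerivAt.clm_apply (hasFDerivAt_const (EuclideanSpace.single l (1 : ℝ)) x)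
    unfold partialDeriv
    rw [this.fderiv]
    simp
  rw [h, h]
  exact ((hF.contDiffAt hnhds).isSymmSndFDerivAt (by simp)) _ _

/-- Euler's relation for a partial derivative of a function that is homogeneous of degree `0`. -/
lemma sum_coord_mul_partialDeriv_partialDeriv {F : Eu n → ℝ} (hF : ContDiffOn ℝ 2 F {0}ᶜ)
    (hE : ∀ x ≠ 0, ∑ j, x j * partialDeriv j F x = 0) {x : Eu n} (hx : x ≠ 0) (i : Fin n) :
    ∑ j, x j * partialDeriv j (partialDeriv i F) x = -partialDeriv i F x := by
  have hc : ∀ j, ContDiffOn ℝ 1 (fun x : Eu n => x j * partialDeriv j F x) {0}ᶜ := fun j =>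
    (contDiff_coord j).contDiffOn.mul (contDiffOn_partialDeriv hF j)
  have h0 : partialDeriv i (fun x => ∑ j, x j * partialDeriv j F x) x = 0 := by
    have : (fun x : Eu n => ∑ j, x j * partialDeriv j F x) =ᶠ[nhds x] fun _ => 0 :=
      Filter.eventually_of_mem (isOpen_compl_singleton.mem_nhds
        (show x ∈ ({0}ᶜ : Set (Eu n)) from hx)) fun y hy => hE y hy
    unfold partialDeriv at *
    rw [this.fderiv_eq]
    simp
  rw [partialDeriv_sum _ hc hx] at h0
  have h1 : ∀ j, partialDeriv i (fun x : Eu n => x j * partialDeriv j F x) x =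
      x j * partialDeriv j (partialDeriv i F) x + if j = i then partialDeriv j F x else 0 := fun j => by
    rw [partialDeriv_mul (contDiff_coord j).contDiffOn (contDiffOn_partialDeriv hF j) hx,
      partialDeriv_coord, partialDeriv_comm hF hx i j]
    split_ifs <;> simp
  simp only [h1, Finset.sum_add_distrib, Finset.sum_ite_eq', Finset.mem_univ, if_true] at h0
  linarith

variable [NeZero n]

/-- Integration by parts on the sphere, for functions that need not be homogeneous. -/
theorem integral_partialDeriv_unifSphere (hR : 0 < R) {F : Eu n → ℝ} (hF : ContDiffOn ℝ 1 F {0}ᶜ)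
    (i : Fin n) :
    ∫ z : Sph n R, (R ^ 2 * partialDeriv i F z - (z : Eu n) i * ∑ j, (z : Eu n) j * partialDeriv j F z -
      ((n : ℝ) - 1) * ((z : Eu n) i * F z)) ∂unifSphere n R = 0 := by
  have hc : ∀ j, ContDiffOn ℝ 1 (fun x : Eu n => x j * F x) {0}ᶜ := fun j =>
    (contDiff_coord j).contDiffOn.mul hF
  -- The rotation identity in the plane of coordinates `j` and `i`, applied to `x_j F`. In the sum
  -- over `j` the undifferentiated terms are `n` copies of `-z_i F` and one `z_i F` from `j = i`,
  -- hence the factor `n - 1`.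
  have hint : ∀ j, ∫ z : Sph n R, ((z : Eu n) j * partialDeriv i (fun x => x j * F x) z -
      (z : Eu n) i * partialDeriv j (fun x => x j * F x) z) ∂unifSphere n R = 0 := by
    intro j
    rcases eq_or_ne j i with rfl | hji
    · simp
    · have h := integral_fderiv_rotation hR (hc j) (u := EuclideanSpace.single j 1)
        (v := EuclideanSpace.single i 1) (by simp) (by simp)
        (by simp [EuclideanSpace.inner_single_left, hji])
      simpa [EuclideanSpace.inner_single_left, partialDeriv] using h
  have hs := Finset.sum_congr (rfl : (Finset.univ : Finset (Fin n)) = _) fun j _ => hint j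
  rw [← integral_finsetSum] at hs
  · rw [Finset.sum_const_zero] at hs
    rw [← hs]
    congr 1 with z
    have hz := ne_zero_of_mem_sphere hR z
    have hn : ∑ j, (z : Eu n) j * (z : Eu n) j = R ^ 2 := by
      have h := EuclideanSpace.real_norm_sq_eq (z : Eu n)
      rw [norm_eq_of_mem_sphere z] at h
      simp_rw [← pow_two]
      exact h.symm
    have h1 : ∀ j, (z : Eu n) j * partialDeriv i (fun x => x j * F x) z -
        (z : Eu n) i * partialDeriv j (fun x => x j * F x) z =
        ((z : Eu n) j * (z : Eu n) j) * partialDeriv i F z + (if j = i then (z : Eu n) j * F z else 0)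
        - (z : Eu n) i * ((z : Eu n) j * partialDeriv j F z) - (z : Eu n) i * F z := fun j => by
      rw [partialDeriv_mul (contDiff_coord j).contDiffOn hF hz, partialDeriv_coord,
        partialDeriv_mul (contDiff_coord j).contDiffOn hF hz, partialDeriv_coord, if_pos rfl]
      split_ifs <;> simp <;> ring
    simp only [h1, Finset.sum_add_distrib, Finset.sum_sub_distrib, Finset.sum_ite_eq',
      Finset.mem_univ, if_true, ← Finset.sum_mul, ← Finset.mul_sum, hn, Finset.sum_const,
      Finset.card_univ, Fintype.card_fin, nsmul_eq_mul]
    ring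
  · intro j _
    have h1 := continuousOn_partialDeriv (hc j)
    exact integrable_unifSphere hR (g := fun x : Eu n => x j * partialDeriv i (fun x => x j * F x) x -
      x i * partialDeriv j (fun x => x j * F x) x) (by have := h1 i; have := h1 j; fun_prop)

/-- The second-order identity for functions that are homogeneous of degree `0`. -/
theorem integral_second_order_unifSphere (hR : 0 < R) (hn : 3 ≤ n) {F : Fin n → Eu n → ℝ}
    (hF : ∀ i, ContDiffOn ℝ 2 (F i) {0}ᶜ)
    (hE : ∀ i, ∀ x ≠ 0, ∑ j, x j * partialDeriv j (F i) x = 0) :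
    ∫ z : Sph n R, ((n : ℝ) * (R ^ 2)⁻¹ * (∑ i, (z : Eu n) i * F i z) -
        ∑ i, partialDeriv i (F i) z) ^ 2 ∂unifSphere n R =
      (n : ℝ) * (R ^ 2)⁻¹ * ∫ z : Sph n R, ∑ i, F i z ^ 2 ∂unifSphere n R +
      (n : ℝ) * ((n : ℝ) - 2)⁻¹ * ∫ z : Sph n R, ∑ i, ∑ j, partialDeriv j (F i) z *
        partialDeriv i (F j) z ∂unifSphere n R -
      2 * ((n : ℝ) - 2)⁻¹ * ∫ z : Sph n R, (∑ i, partialDeriv i (F i) z) ^ 2 ∂unifSphere n R := by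
  have hF1 : ∀ i, ContDiffOn ℝ 1 (F i) {0}ᶜ := fun i => (hF i).of_le (by norm_num)
  have hFc : ∀ i, ContinuousOn (F i) {0}ᶜ := fun i => (hF i).continuousOn
  have hD1 : ∀ i j, ContDiffOn ℝ 1 (partialDeriv j (F i)) {0}ᶜ := fun i j =>
    contDiffOn_partialDeriv (hF i) j
  have hDc : ∀ i j, ContinuousOn (partialDeriv j (F i)) {0}ᶜ := fun i j => (hD1 i j).continuousOn
  have hDDc : ∀ i j k, ContinuousOn (partialDeriv k (partialDeriv j (F i))) {0}ᶜ := fun i j k =>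
    continuousOn_partialDeriv (hD1 i j) k
  set φ : Eu n → ℝ := fun x => ∑ i, x i * F i x
  have hφ1 : ContDiffOn ℝ 1 φ {0}ᶜ :=
    ContDiffOn.sum fun i _ => (contDiff_coord i).contDiffOn.mul (hF1 i)
  have hφc : ContinuousOn φ {0}ᶜ := hφ1.continuousOn
  have hφd : ∀ x ≠ 0, ∀ i, partialDeriv i φ x = F i x + ∑ j, x j * partialDeriv i (F j) x := by
    intro x hx i
    have h1 : ∀ j, partialDeriv i (fun x : Eu n => x j * F j x) x =
        (if j = i then F j x else 0) + x j * partialDeriv i (F j) x := fun j => by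
      rw [partialDeriv_mul (contDiff_coord j).contDiffOn (hF1 j) hx, partialDeriv_coord]
      split_ifs <;> simp
      ring
    simp only [φ]
    rw [partialDeriv_sum _ (fun j => (contDiff_coord j).contDiffOn.mul (hF1 j)) hx]
    simp [h1, Finset.sum_add_distrib]
  -- Euler's relation for `φ`, which is homogeneous of degree 1.
  have hφE : ∀ x ≠ 0, ∑ j, x j * partialDeriv j φ x = φ x := by
    intro x hx
    simp only [hφd x hx, mul_add, Finset.sum_add_distrib, φ]
    rw [add_eq_left]
    simp only [Finset.mul_sum]
    rw [Finset.sum_comm]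
    refine Finset.sum_eq_zero fun i _ => ?_
    simp only [mul_left_comm _ (x i), ← Finset.mul_sum, hE i x hx, mul_zero]
  set div : Eu n → ℝ := fun x => ∑ i, partialDeriv i (F i) x
  have hdivc : ContinuousOn div {0}ᶜ := by simp only [div]; fun_prop
  set S : Eu n → ℝ := fun x => ∑ i, ∑ j, F i x * (x j * partialDeriv i (F j) x)
  have hSc : ContinuousOn S {0}ᶜ := by simp only [S]; fun_prop
  set T : Eu n → ℝ := fun x => ∑ i, ∑ j, partialDeriv j (F i) x * partialDeriv i (F j) x
  have hTc : ContinuousOn T {0}ᶜ := by simp only [T]; fun_prop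
  set N : Eu n → ℝ := fun x => ∑ i, F i x ^ 2
  have hNc : ContinuousOn N {0}ᶜ := by simp only [N]; fun_prop
  -- Integration by parts for `F i * φ`, summed over `i`. Degree 1 adds one more `z_i F_i φ`,
  -- raising `n - 1` to `n`.
  have heq1 : ∫ z : Sph n R, (R ^ 2 * (φ z * div z + N z + S z) - (n : ℝ) * φ z ^ 2)
      ∂unifSphere n R = 0 := by
    have hs := Finset.sum_congr (rfl : (Finset.univ : Finset (Fin n)) = _) fun i _ =>
      integral_partialDeriv_unifSphere hR ((hF1 i).mul hφ1) i
    have hGc : ∀ i j, ContinuousOn (partialDeriv i fun x => F j x * φ x) {0}ᶜ := fun i j =>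
      continuousOn_partialDeriv ((hF1 j).mul hφ1) i
    rw [← integral_finsetSum _ fun i _ => integrable_unifSphere hR
      (g := fun z : Eu n => R ^ 2 * partialDeriv i (fun x => F i x * φ x) z -
        z i * ∑ j, z j * partialDeriv j (fun x => F i x * φ x) z -
        ((n : ℝ) - 1) * (z i * (F i z * φ z))) (by fun_prop), Finset.sum_const_zero] at hs
    rw [← hs]
    congr 1 with z
    have hz := ne_zero_of_mem_sphere hR z
    have h1 : ∀ i, R ^ 2 * partialDeriv i (fun x => F i x * φ x) z -
        (z : Eu n) i * ∑ j, (z : Eu n) j * partialDeriv j (fun x => F i x * φ x) z -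
        ((n : ℝ) - 1) * ((z : Eu n) i * (F i z * φ z)) =
        R ^ 2 * (φ z * partialDeriv i (F i) z + F i z ^ 2 +
          ∑ j, F i z * ((z : Eu n) j * partialDeriv i (F j) z)) - (n : ℝ) * (φ z * ((z : Eu n) i * F i z)) := by
      intro i
      have h2 : ∑ j, (z : Eu n) j * partialDeriv j (fun x => F i x * φ x) z = F i z * φ z := by
        simp only [partialDeriv_mul (hF1 i) hφ1 hz, mul_add, Finset.sum_add_distrib,
          mul_left_comm _ (F i z), ← mul_assoc _ _ (φ z), ← Finset.mul_sum, ← Finset.sum_mul,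
          hφE _ hz, hE i _ hz]
        ring
      rw [h2, partialDeriv_mul (hF1 i) hφ1 hz, hφd _ hz, ← Finset.mul_sum]
      ring
    simp only [h1, Finset.sum_sub_distrib, ← Finset.mul_sum, Finset.sum_add_distrib]
    simp only [φ, div, N, S, ← Finset.mul_sum]
    ring
  -- Integration by parts for `F i * ∂_l (F j)`, of degree -1, so that `n - 1` drops to `n - 2`. The
  -- cases `(k, l) = (i, j)` and `(j, i)` are subtracted so that the second derivatives cancel by
  -- symmetry.
  have heq2 : ∫ z : Sph n R, (R ^ 2 * (div z ^ 2 - T z) - ((n : ℝ) - 2) * (φ z * div z - S z))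
      ∂unifSphere n R = 0 := by
    have hibp : ∀ i j k l, ∫ z : Sph n R, (R ^ 2 * (F i z * partialDeriv k (partialDeriv l (F j)) z +
        partialDeriv k (F i) z * partialDeriv l (F j) z) -
        ((n : ℝ) - 2) * ((z : Eu n) k * (F i z * partialDeriv l (F j) z))) ∂unifSphere n R = 0 := by
      intro i j k l
      rw [← integral_partialDeriv_unifSphere hR ((hF1 i).mul (hD1 j l)) k]
      congr 1 with z
      have hz := ne_zero_of_mem_sphere hR z
      have h2 : ∑ m, (z : Eu n) m * partialDeriv m (fun x => F i x * partialDeriv l (F j) x) z =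
          -(F i z * partialDeriv l (F j) z) := by
        simp only [partialDeriv_mul (hF1 i) (hD1 j l) hz, mul_add, Finset.sum_add_distrib,
          mul_left_comm _ (F i z), ← mul_assoc _ _ (partialDeriv l (F j) z), ← Finset.mul_sum,
          ← Finset.sum_mul, hE i _ hz, sum_coord_mul_partialDeriv_partialDeriv (hF j) (hE j) hz]
        ring
      rw [h2, partialDeriv_mul (hF1 i) (hD1 j l) hz]
      ring
    have hint : ∀ i j k l, Integrable (fun z : Sph n R =>
        R ^ 2 * (F i z * partialDeriv k (partialDeriv l (F j)) z +
        partialDeriv k (F i) z * partialDeriv l (F j) z) -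
        ((n : ℝ) - 2) * ((z : Eu n) k * (F i z * partialDeriv l (F j) z))) (unifSphere n R) :=
      fun i j k l => integrable_unifSphere hR (g := fun z : Eu n =>
        R ^ 2 * (F i z * partialDeriv k (partialDeriv l (F j)) z +
        partialDeriv k (F i) z * partialDeriv l (F j) z) -
        ((n : ℝ) - 2) * (z k * (F i z * partialDeriv l (F j) z)))
        (by have := hFc i; have := hDc i k; have := hDc j l; have := hDDc j l k; fun_prop)
    have hs : ∫ z : Sph n R, ∑ i, ∑ j,
        ((R ^ 2 * (F i z * partialDeriv i (partialDeriv j (F j)) z +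
          partialDeriv i (F i) z * partialDeriv j (F j) z) -
          ((n : ℝ) - 2) * ((z : Eu n) i * (F i z * partialDeriv j (F j) z))) -
        (R ^ 2 * (F i z * partialDeriv j (partialDeriv i (F j)) z +
          partialDeriv j (F i) z * partialDeriv i (F j) z) -
          ((n : ℝ) - 2) * ((z : Eu n) j * (F i z * partialDeriv i (F j) z)))) ∂unifSphere n R = 0 := by
      refine (integral_finsetSum _ fun i _ => integrable_finsetSum _ fun j _ =>
        (hint i j i j).sub (hint i j j i)).trans (Finset.sum_eq_zero fun i _ => ?_)
      refine (integral_finsetSum _ fun j _ => (hint i j i j).sub (hint i j j i)).trans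
        (Finset.sum_eq_zero fun j _ => ?_)
      refine (integral_sub (hint i j i j) (hint i j j i)).trans ?_
      rw [hibp, hibp, sub_zero]
    rw [← hs]
    congr 1 with z
    have hz := ne_zero_of_mem_sphere hR z
    have h1 : ∀ i j, ((R ^ 2 * (F i z * partialDeriv i (partialDeriv j (F j)) z +
          partialDeriv i (F i) z * partialDeriv j (F j) z) -
          ((n : ℝ) - 2) * ((z : Eu n) i * (F i z * partialDeriv j (F j) z))) -
        (R ^ 2 * (F i z * partialDeriv j (partialDeriv i (F j)) z +
          partialDeriv j (F i) z * partialDeriv i (F j) z) -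
          ((n : ℝ) - 2) * ((z : Eu n) j * (F i z * partialDeriv i (F j) z)))) =
        R ^ 2 * (partialDeriv i (F i) z * partialDeriv j (F j) z) -
        R ^ 2 * (partialDeriv j (F i) z * partialDeriv i (F j) z) -
        ((n : ℝ) - 2) * ((z : Eu n) i * F i z * partialDeriv j (F j) z) +
        ((n : ℝ) - 2) * (F i z * ((z : Eu n) j * partialDeriv i (F j) z)) := fun i j => by
      rw [partialDeriv_comm (hF j) hz i j]
      ring
    simp only [h1, Finset.sum_add_distrib, Finset.sum_sub_distrib]
    simp only [← Finset.mul_sum, ← Finset.sum_mul]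
    simp only [φ, div, S, T, ← Finset.mul_sum]
    ring
  have hn' : (3 : ℝ) ≤ n := by exact_mod_cast hn
  have hn2 : (n : ℝ) - 2 ≠ 0 := by linarith
  have hi : ∀ {g : Eu n → ℝ}, ContinuousOn g {0}ᶜ →
    Integrable (fun z : Sph n R => g z) (unifSphere n R) := fun hg => integrable_unifSphere hR hg
  have iA := hi (g := fun z => φ z ^ 2) (by fun_prop)
  have iB := hi (g := fun z => φ z * div z) (by fun_prop)
  have iC := hi (g := fun z => div z ^ 2) (by fun_prop)
  have iS := hi hSc
  have iT := hi hTc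
  have iN := hi hNc
  have iBN := hi (g := fun z => φ z * div z + N z) (by fun_prop)
  have iBNS := hi (g := fun z => φ z * div z + N z + S z) (by fun_prop)
  have iCT := hi (g := fun z => div z ^ 2 - T z) (by fun_prop)
  have iBS := hi (g := fun z => φ z * div z - S z) (by fun_prop)
  rw [integral_sub (iBNS.const_mul _) (iA.const_mul _), integral_const_mul,
    integral_const_mul, integral_add iBN iS, integral_add iB iN] at heq1
  rw [integral_sub (iCT.const_mul _) (iBS.const_mul _), integral_const_mul,
    integral_const_mul, integral_sub iC iT, integral_sub iB iS] at heq2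
  have hL : ∫ z : Sph n R, ((n : ℝ) * (R ^ 2)⁻¹ * φ z - div z) ^ 2 ∂unifSphere n R =
      ((n : ℝ) * (R ^ 2)⁻¹) ^ 2 * ∫ z : Sph n R, φ z ^ 2 ∂unifSphere n R -
      2 * ((n : ℝ) * (R ^ 2)⁻¹) * ∫ z : Sph n R, φ z * div z ∂unifSphere n R +
      ∫ z : Sph n R, div z ^ 2 ∂unifSphere n R := by
    rw [← integral_const_mul, ← integral_const_mul, ← integral_sub (iA.const_mul _) (iB.const_mul _),
      ← integral_add ?_ iC]
    · congr 1 with z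
      ring
    · exact (iA.const_mul _).sub (iB.const_mul _)
  refine hL.trans ?_
  change _ = (n : ℝ) * (R ^ 2)⁻¹ * ∫ z : Sph n R, N z ∂unifSphere n R +
      (n : ℝ) * ((n : ℝ) - 2)⁻¹ * ∫ z : Sph n R, T z ∂unifSphere n R -
      2 * ((n : ℝ) - 2)⁻¹ * ∫ z : Sph n R, div z ^ 2 ∂unifSphere n R
  generalize (∫ z : Sph n R, φ z ^ 2 ∂unifSphere n R) = A at *
  generalize (∫ z : Sph n R, φ z * div z ∂unifSphere n R) = B at *
  generalize (∫ z : Sph n R, div z ^ 2 ∂unifSphere n R) = C at *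
  generalize (∫ z : Sph n R, N z ∂unifSphere n R) = N' at *
  generalize (∫ z : Sph n R, T z ∂unifSphere n R) = T' at *
  generalize (∫ z : Sph n R, S z ∂unifSphere n R) = S' at *
  have hR2 : R ^ 2 ≠ 0 := by positivity
  -- `heq2` is solved for `T'` and `heq1` for `S'`; after substitution the claim is an algebraic
  -- identity in `A`, `B`, `C` and `N'`.
  have hT : T' = C - ((n : ℝ) - 2) * (R ^ 2)⁻¹ * (B - S') := by
    field_simp; linarith
  have hS : S' = n * A * (R ^ 2)⁻¹ - B - N' := by
    field_simp; linarith
  rw [hT, hS]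
  field_simp
  ring

end IntegrationByParts
-- The Poincaré inequality on the sphere.
section SpherePoincare

variable {n : ℕ} {R : ℝ}

lemma div_norm_pos (hR : 0 < R) {x : Eu n} (hx : x ≠ 0) : 0 < R / ‖x‖ :=
  div_pos hR (norm_pos_iff.2 hx)

lemma eq_comp_sphereProj (hR : 0 < R) {F : Eu n → ℝ}
    (hhom : ∀ (c : ℝ) (x : Eu n), 0 < c → F (c • x) = F x) {x : Eu n} (hx : x ≠ 0) :
    F (sphereProj R x) = F x := hhom _ _ (div_norm_pos hR hx)

/-- The derivative of a function of degree 0 has degree -1: differentiate `F (c • y) = F y` with `c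
= R / ‖x‖`. -/
lemma fderiv_eq_smul_sphereProj (hR : 0 < R) {F : Eu n → ℝ} (hF : ContDiffOn ℝ 1 F {0}ᶜ)
    (hhom : ∀ (c : ℝ) (x : Eu n), 0 < c → F (c • x) = F x) {x : Eu n} (hx : x ≠ 0) :
    fderiv ℝ F x = (R / ‖x‖) • fderiv ℝ F (sphereProj R x) := by
  have hc := div_norm_pos hR hx
  set c := R / ‖x‖
  have h : HasFDerivAt (fun y => F (c • y))
      ((fderiv ℝ F (sphereProj R x)).comp (c • ContinuousLinearMap.id ℝ (Eu n))) x :=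
    HasFDerivAt.comp x (f := fun y => c • y)
      (hasFDerivAt_of_contDiffOn hF (sphereProj_ne_zero hR hx)) ((hasFDerivAt_id x).const_smul c)
  have h2 : (fun y => F (c • y)) = F := funext fun y => hhom c y hc
  rw [h2] at h
  rw [h.fderiv]
  ext y
  simp

lemma exists_bounds_of_homogeneous (hR : 0 < R) {F : Eu n → ℝ} (hF : ContDiffOn ℝ 1 F {0}ᶜ)
    (hhom : ∀ (c : ℝ) (x : Eu n), 0 < c → F (c • x) = F x) :
    ∃ C, 0 ≤ C ∧ (∀ x ≠ 0, |F x| ≤ C) ∧ ∀ x ≠ 0, ‖fderiv ℝ F x‖ ≤ C * ‖x‖⁻¹ := by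
  have hsub : Metric.sphere (0 : Eu n) R ⊆ {0}ᶜ := fun x hx => ne_zero_of_mem_sphere hR ⟨x, hx⟩
  obtain ⟨M, hM⟩ := (isCompact_sphere (0 : Eu n) R).exists_bound_of_continuousOn
    (hF.continuousOn.mono hsub)
  obtain ⟨K, hK⟩ := (isCompact_sphere (0 : Eu n) R).exists_bound_of_continuousOn
    ((continuousOn_fderiv hF).mono hsub)
  have hmem : ∀ x : Eu n, x ≠ 0 → sphereProj R x ∈ Metric.sphere (0 : Eu n) R := fun x hx => by
    simpa using norm_sphereProj hR hx
  refine ⟨max 0 (max M (R * K)), le_max_left _ _, fun x hx => ?_, fun x hx => ?_⟩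
  · rw [← eq_comp_sphereProj hR hhom hx]
    exact (hM _ (hmem x hx)).trans ((le_max_left _ _).trans (le_max_right _ _))
  · have hx' := norm_pos_iff.2 hx
    rw [fderiv_eq_smul_sphereProj hR hF hhom hx, norm_smul, norm_div, norm_norm,
      Real.norm_of_nonneg hR.le, div_eq_mul_inv, mul_right_comm]
    refine mul_le_mul_of_nonneg_right ?_ (by positivity)
    exact (mul_le_mul_of_nonneg_left (hK _ (hmem x hx)) hR.le).trans
      ((le_max_right _ _).trans (le_max_right _ _))

/-- A regularization at the origin of a function on `ℝⁿ ∖ {0}`. -/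
noncomputable def regularize (F : Eu n → ℝ) (ε : ℝ) (x : Eu n) : ℝ :=
  F x * (‖x‖ ^ 2 * (‖x‖ ^ 2 + ε)⁻¹)

lemma abs_regularize_le {F : Eu n → ℝ} {C : ℝ} (hC : ∀ x ≠ 0, |F x| ≤ C)
    {ε : ℝ} (hε : 0 < ε) (x : Eu n) :
    |regularize F ε x| ≤ C * (‖x‖ ^ 2 * (‖x‖ ^ 2 + ε)⁻¹) := by
  rcases eq_or_ne x 0 with rfl | hx
  · simp [regularize]
  · rw [regularize, abs_mul, abs_of_nonneg (show 0 ≤ ‖x‖ ^ 2 * (‖x‖ ^ 2 + ε)⁻¹ by positivity)]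
    exact mul_le_mul_of_nonneg_right (hC x hx) (by positivity)

lemma abs_regularize_le_const {F : Eu n → ℝ} {C : ℝ} (hC0 : 0 ≤ C) (hC : ∀ x ≠ 0, |F x| ≤ C)
    {ε : ℝ} (hε : 0 < ε) (x : Eu n) : |regularize F ε x| ≤ C := by
  refine (abs_regularize_le hC hε x).trans (mul_le_of_le_one_right hC0 ?_)
  rw [← div_eq_mul_inv, div_le_one (by positivity)]
  linarith

/-- The cutoff makes the function `O(‖x‖²)` at the origin, whatever the behaviour of the bounded `F`
there. -/
lemma hasFDerivAt_regularize_zero {F : Eu n → ℝ} {C : ℝ} (hC0 : 0 ≤ C) (hC : ∀ x ≠ 0, |F x| ≤ C)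
    {ε : ℝ} (hε : 0 < ε) : HasFDerivAt (regularize F ε) (0 : Eu n →L[ℝ] ℝ) 0 := by
  refine Asymptotics.IsBigO.hasFDerivAt (n := 2) (Asymptotics.IsBigO.of_bound (C * ε⁻¹)
    (Filter.Eventually.of_forall fun x => ?_)) (by norm_num)
  refine (abs_regularize_le hC hε x).trans ?_
  rw [sub_zero, norm_pow, norm_norm, mul_assoc, mul_comm (ε⁻¹)]
  refine mul_le_mul_of_nonneg_left (mul_le_mul_of_nonneg_left ?_ (by positivity)) hC0
  exact inv_anti₀ hε (by nlinarith [norm_nonneg x])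

lemma hasFDerivAt_regularize {F : Eu n → ℝ} (hF : ContDiffOn ℝ 1 F {0}ᶜ) {ε : ℝ} (hε : 0 < ε)
    {x : Eu n} (hx : x ≠ 0) :
    HasFDerivAt (regularize F ε) ((‖x‖ ^ 2 * (‖x‖ ^ 2 + ε)⁻¹) • fderiv ℝ F x +
      (F x * (2 * (ε * ((‖x‖ ^ 2 + ε) ^ 2)⁻¹))) • innerSL ℝ x) x := by
  have h0 : ‖x‖ ^ 2 + ε ≠ 0 := by positivity
  have h1 := (hasStrictFDerivAt_norm_sq x).hasFDerivAt
  have h2 := (hasFDerivAt_of_contDiffOn hF hx).mul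
    (h1.mul ((hasDerivAt_inv h0).comp_hasFDerivAt x (h1.add_const ε)))
  refine h2.congr_fderiv ?_
  ext y
  simp
  field_simp
  ring

/-- One `C` comes from `∇F` and two from the derivative of the cutoff. The bound is finite for each
`ε` and at most `3C / ‖x‖` uniformly in `ε`; both facts are needed for the limit. -/
lemma norm_fderiv_regularize_le {F : Eu n → ℝ} (hF : ContDiffOn ℝ 1 F {0}ᶜ) {C : ℝ} (hC0 : 0 ≤ C)
    (hC : ∀ x ≠ 0, |F x| ≤ C) (hC' : ∀ x ≠ 0, ‖fderiv ℝ F x‖ ≤ C * ‖x‖⁻¹) {ε : ℝ} (hε : 0 < ε)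
    (x : Eu n) : ‖fderiv ℝ (regularize F ε) x‖ ≤ 3 * C * (‖x‖ * (‖x‖ ^ 2 + ε)⁻¹) := by
  rcases eq_or_ne x 0 with rfl | hx
  · rw [(hasFDerivAt_regularize_zero hC0 hC hε).fderiv]; simp
  have hx' := norm_pos_iff.2 hx
  rw [(hasFDerivAt_regularize hF hε hx).fderiv]
  refine (norm_add_le _ _).trans ?_
  rw [norm_smul, norm_smul, innerSL_apply_norm, norm_mul (F x),
    Real.norm_of_nonneg (show 0 ≤ ‖x‖ ^ 2 * (‖x‖ ^ 2 + ε)⁻¹ by positivity),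
    Real.norm_of_nonneg (show 0 ≤ 2 * (ε * ((‖x‖ ^ 2 + ε) ^ 2)⁻¹) by positivity)]
  have h1 : ‖x‖ ^ 2 * (‖x‖ ^ 2 + ε)⁻¹ * ‖fderiv ℝ F x‖ ≤ C * (‖x‖ * (‖x‖ ^ 2 + ε)⁻¹) := by
    refine (mul_le_mul_of_nonneg_left (hC' x hx) (by positivity)).trans_eq ?_
    field_simp
  have h2 : ‖F x‖ * (2 * (ε * ((‖x‖ ^ 2 + ε) ^ 2)⁻¹)) * ‖x‖ ≤ C * 2 * (‖x‖ * (‖x‖ ^ 2 + ε)⁻¹) := by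
    have h3 : ε * ((‖x‖ ^ 2 + ε) ^ 2)⁻¹ ≤ (‖x‖ ^ 2 + ε)⁻¹ := by
      rw [pow_two (‖x‖ ^ 2 + ε), mul_inv, ← mul_assoc]
      refine mul_le_of_le_one_left (by positivity) ?_
      rw [← div_eq_mul_inv, div_le_one (by positivity)]
      nlinarith
    calc _ ≤ C * (2 * (‖x‖ ^ 2 + ε)⁻¹) * ‖x‖ := by
          refine mul_le_mul_of_nonneg_right (mul_le_mul (hC x hx)
            (mul_le_mul_of_nonneg_left h3 (by norm_num)) (by positivity) hC0) hx'.le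
      _ = _ := by ring
  linarith

lemma integrable_norm_inv_sq (hn : 3 ≤ n) :
    Integrable (fun x : Eu n => (‖x‖ ^ 2)⁻¹) (stdGaussian (Eu n)) := by
  refine ⟨by fun_prop, ?_⟩
  have h := lintegral_norm_inv_sq_mul_stdGaussian (E := Eu n) (by simpa using hn) (q := fun _ => 1)
    measurable_const (by simp)
  simp only [mul_one] at h
  rw [hasFiniteIntegral_iff_ofReal (Filter.Eventually.of_forall fun x => by positivity), h]
  simp

/-- The Gaussian Poincaré inequality for functions that are homogeneous of degree `0`. -/
lemma poincare_stdGaussian_of_homogeneous (hR : 0 < R) (hn : 3 ≤ n) {F : Eu n → ℝ}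
    (hF : ContDiffOn ℝ 1 F {0}ᶜ) (hhom : ∀ (c : ℝ) (x : Eu n), 0 < c → F (c • x) = F x) :
    ∫ x, F x ^ 2 ∂stdGaussian (Eu n) - (∫ x, F x ∂stdGaussian (Eu n)) ^ 2 ≤
      ∫ x, ‖fderiv ℝ F x‖ ^ 2 ∂stdGaussian (Eu n) := by
  have : NeZero n := ⟨by omega⟩
  obtain ⟨C, hC0, hC, hC'⟩ := exists_bounds_of_homogeneous hR hF hhom
  set ε : ℕ → ℝ := fun k => 1 / ((k : ℝ) + 1)
  have hε : ∀ k, 0 < ε k := fun k => by simp only [ε]; positivity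
  have hεt : Filter.Tendsto ε Filter.atTop (nhds 0) := tendsto_one_div_add_atTop_nhds_zero_nat
  have hdiff : ∀ k, Differentiable ℝ (regularize F (ε k)) := fun k x => by
    rcases eq_or_ne x 0 with rfl | hx
    · exact (hasFDerivAt_regularize_zero hC0 hC (hε k)).differentiableAt
    · exact (hasFDerivAt_regularize hF (hε k) hx).differentiableAt
  have hineq : ∀ k, ∫ x, regularize F (ε k) x ^ 2 ∂stdGaussian (Eu n) -
      (∫ x, regularize F (ε k) x ∂stdGaussian (Eu n)) ^ 2 ≤
      ∫ x, ‖fderiv ℝ (regularize F (ε k)) x‖ ^ 2 ∂stdGaussian (Eu n) := fun k => by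
    -- This derivative bound blows up as `ε → 0`; only its finiteness for fixed `k` matters.
    refine poincare_stdGaussian (hdiff k) (abs_regularize_le_const hC0 hC (hε k))
      (K := 3 * C * (1 + (ε k)⁻¹)) fun x => ?_
    refine (norm_fderiv_regularize_le hF hC0 hC hC' (hε k) x).trans
      (mul_le_mul_of_nonneg_left ?_ (by positivity))
    have := hε k
    rw [← div_eq_mul_inv, div_le_iff₀ (by positivity)]
    have h1 : (1 + (ε k)⁻¹) * (‖x‖ ^ 2 + ε k) = ‖x‖ ^ 2 + ε k + (ε k)⁻¹ * ‖x‖ ^ 2 + 1 := by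
      field_simp
      ring
    rw [h1]
    have : 0 ≤ (ε k)⁻¹ * ‖x‖ ^ 2 := by positivity
    nlinarith [sq_nonneg (‖x‖ - 1), norm_nonneg x]
  have hlim1 : ∀ x : Eu n, x ≠ 0 →
      Filter.Tendsto (fun k => ‖x‖ ^ 2 * (‖x‖ ^ 2 + ε k)⁻¹) Filter.atTop (nhds 1) := fun x hx => by
    have hx' : ‖x‖ ^ 2 ≠ 0 := by have := norm_pos_iff.2 hx; positivity
    have h := ((hεt.const_add (‖x‖ ^ 2)).inv₀ (by simpa using hx')).const_mul (‖x‖ ^ 2)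
    simpa [hx'] using h
  have hlim2 : ∀ x : Eu n, x ≠ 0 →
      Filter.Tendsto (fun k => regularize F (ε k) x) Filter.atTop (nhds (F x)) := fun x hx => by
    simpa [regularize] using (hlim1 x hx).const_mul (F x)
  have hlim3 : ∀ x : Eu n, x ≠ 0 →
      Filter.Tendsto (fun k => fderiv ℝ (regularize F (ε k)) x) Filter.atTop
        (nhds (fderiv ℝ F x)) := fun x hx => by
    have hx' : ‖x‖ ^ 2 ≠ 0 := by have := norm_pos_iff.2 hx; positivity
    have h2 : Filter.Tendsto (fun k => F x * (2 * (ε k * ((‖x‖ ^ 2 + ε k) ^ 2)⁻¹))) Filter.atTop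
        (nhds 0) := by
      have h := ((hεt.mul (((hεt.const_add (‖x‖ ^ 2)).pow 2).inv₀ (by simpa using hx'))).const_mul
        2).const_mul (F x)
      simpa using h
    have h := ((hlim1 x hx).smul_const (fderiv ℝ F x)).add (h2.smul_const (innerSL ℝ x))
    simp only [one_smul, zero_smul, add_zero] at h
    exact h.congr fun k => ((hasFDerivAt_regularize hF (hε k) hx).fderiv).symm
  have hne := stdGaussian_ae_ne_zero (E := Eu n)
  have t1 : Filter.Tendsto (fun k => ∫ x, regularize F (ε k) x ^ 2 ∂stdGaussian (Eu n)) Filter.atTop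
      (nhds (∫ x, F x ^ 2 ∂stdGaussian (Eu n))) := by
    refine tendsto_integral_of_dominated_convergence (fun _ => C ^ 2)
      (fun k => ((hdiff k).continuous.pow 2).aestronglyMeasurable) (integrable_const _)
      (fun k => Filter.Eventually.of_forall fun x => ?_) (hne.mono fun x hx => (hlim2 x hx).pow 2)
    rw [norm_pow]
    exact pow_le_pow_left₀ (norm_nonneg _) (abs_regularize_le_const hC0 hC (hε k) x) 2
  have t2 : Filter.Tendsto (fun k => ∫ x, regularize F (ε k) x ∂stdGaussian (Eu n)) Filter.atTop
      (nhds (∫ x, F x ∂stdGaussian (Eu n))) := by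
    refine tendsto_integral_of_dominated_convergence (fun _ => C)
      (fun k => (hdiff k).continuous.aestronglyMeasurable) (integrable_const _)
      (fun k => Filter.Eventually.of_forall fun x => abs_regularize_le_const hC0 hC (hε k) x)
      (hne.mono fun x hx => hlim2 x hx)
  have t3 : Filter.Tendsto (fun k => ∫ x, ‖fderiv ℝ (regularize F (ε k)) x‖ ^ 2 ∂stdGaussian (Eu n))
      Filter.atTop (nhds (∫ x, ‖fderiv ℝ F x‖ ^ 2 ∂stdGaussian (Eu n))) := by
    -- The dominating function is `(3C / ‖x‖)²`, integrable because `n ≥ 3`.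
    refine tendsto_integral_of_dominated_convergence (fun x => (3 * C) ^ 2 * (‖x‖ ^ 2)⁻¹)
      (fun k => ((measurable_fderiv ℝ _).norm.pow_const 2).aestronglyMeasurable)
      ((integrable_norm_inv_sq hn).const_mul _)
      (fun k => hne.mono fun x hx => ?_) (hne.mono fun x hx => (hlim3 x hx).norm.pow 2)
    have hx' := norm_pos_iff.2 hx
    rw [norm_pow, norm_norm, ← inv_pow, ← mul_pow]
    refine pow_le_pow_left₀ (norm_nonneg _) ((norm_fderiv_regularize_le hF hC0 hC hC' (hε k) x).trans
      (mul_le_mul_of_nonneg_left ?_ (by positivity))) 2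
    have := hε k
    rw [← div_eq_mul_inv, div_le_iff₀ (by positivity)]
    field_simp
    linarith
  exact le_of_tendsto_of_tendsto' (t1.sub (t2.pow 2)) t3 hineq

/-- The Poincaré inequality on the sphere for homogeneous functions of degree `0`. -/
theorem poincare_unifSphere (hR : 0 < R) (hn : 3 ≤ n) {F : Eu n → ℝ}
    (hF : ContDiffOn ℝ 1 F {0}ᶜ) (hhom : ∀ (c : ℝ) (x : Eu n), 0 < c → F (c • x) = F x) :
    ∫ z : Sph n R, F z ^ 2 ∂unifSphere n R - (∫ z : Sph n R, F z ∂unifSphere n R) ^ 2 ≤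
      ((n : ℝ) - 2)⁻¹ * R ^ 2 * ∫ z : Sph n R, ‖fderiv ℝ F z‖ ^ 2 ∂unifSphere n R := by
  have : NeZero n := ⟨by omega⟩
  have hn' : (3 : ℝ) ≤ n := by exact_mod_cast hn
  have hFm := measurable_of_contDiffOn hF
  have hne := stdGaussian_ae_ne_zero (E := Eu n)
  have hdm : Measurable (fderiv ℝ F) := measurable_fderiv ℝ F
  have h := poincare_stdGaussian_of_homogeneous hR hn hF hhom
  have e1 : ∫ z : Sph n R, F z ^ 2 ∂unifSphere n R = ∫ x, F x ^ 2 ∂stdGaussian (Eu n) := by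
    rw [integral_unifSphere hR (g := fun x => F x ^ 2) (hFm.pow_const 2).stronglyMeasurable]
    exact integral_congr_ae (hne.mono fun x hx => by simp only [eq_comp_sphereProj hR hhom hx])
  have e2 : ∫ z : Sph n R, F z ∂unifSphere n R = ∫ x, F x ∂stdGaussian (Eu n) := by
    rw [integral_unifSphere hR hFm.stronglyMeasurable]
    exact integral_congr_ae (hne.mono fun x hx => eq_comp_sphereProj hR hhom hx)
  -- Degree -1 splits the squared derivative into `R² / ‖x‖²` times a function of the direction, and
  -- the radial factor integrates to `R² / (n - 2)`.
  have e3 : ∫ x, ‖fderiv ℝ F x‖ ^ 2 ∂stdGaussian (Eu n) =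
      ((n : ℝ) - 2)⁻¹ * R ^ 2 * ∫ z : Sph n R, ‖fderiv ℝ F z‖ ^ 2 ∂unifSphere n R := by
    have hm : Measurable fun x : Eu n => ENNReal.ofReal (‖fderiv ℝ F x‖ ^ 2) :=
      (hdm.norm.pow_const 2).ennreal_ofReal
    have hl := lintegral_norm_inv_sq_mul_stdGaussian (E := Eu n) (by simpa using hn)
      (hm.comp (measurable_sphereProj (R := R)))
      (fun c x hc => by simp only [Function.comp_apply, sphereProj_smul hc])
    rw [finrank_euclideanSpace_fin] at hl
    simp only [Function.comp_apply] at hl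
    rw [← lintegral_unifSphere hR hm] at hl
    have hx : ∀ x : Eu n, x ≠ 0 → ENNReal.ofReal (‖fderiv ℝ F x‖ ^ 2) = ENNReal.ofReal (R ^ 2) *
        (ENNReal.ofReal (‖x‖ ^ 2)⁻¹ * ENNReal.ofReal (‖fderiv ℝ F (sphereProj R x)‖ ^ 2)) :=
      fun x hx => by
        rw [← ENNReal.ofReal_mul (by positivity), ← ENNReal.ofReal_mul (by positivity),
          fderiv_eq_smul_sphereProj hR hF hhom hx, norm_smul, norm_div, norm_norm,
          Real.norm_of_nonneg hR.le]
        congr 1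
        ring
    rw [integral_eq_lintegral_of_nonneg_ae (Filter.Eventually.of_forall fun x => by positivity)
        (hdm.norm.pow_const 2).aestronglyMeasurable,
      integral_eq_lintegral_of_nonneg_ae (f := fun z : Sph n R => ‖fderiv ℝ F z‖ ^ 2)
        (Filter.Eventually.of_forall fun x => by positivity)
        ((hdm.norm.pow_const 2).comp measurable_subtype_coe).aestronglyMeasurable,
      lintegral_congr_ae (hne.mono hx), lintegral_const_mul' _ _ (by simp), hl, ENNReal.toReal_mul,
      ENNReal.toReal_mul, ENNReal.toReal_ofReal (by positivity), ENNReal.toReal_ofReal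
        (inv_nonneg.2 (by linarith))]
    ring
  rw [e1, e2, ← e3]
  exact h

end SpherePoincare
-- Continuous dependence in `L^α`, for the passage to the closure.
section LpContinuous

variable {X S : Type*} [TopologicalSpace X] [MeasurableSpace S]

/-- A family of functions that depends continuously in `L^α` on the parameter. -/
def LpContinuous (α : ℝ≥0∞) [Fact (1 ≤ α)] (σ : Measure S) (q : X → S → ℝ) : Prop :=
  ∃ T : X → Lp ℝ α σ, Continuous T ∧ ∀ x, T x =ᵐ[σ] q x

namespace LpContinuous

variable {α : ℝ≥0∞} [Fact (1 ≤ α)] {σ : Measure S} {q r : X → S → ℝ}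

lemma add (hq : LpContinuous α σ q) (hr : LpContinuous α σ r) :
    LpContinuous α σ fun x z => q x z + r x z := by
  obtain ⟨T, hT, hTq⟩ := hq
  obtain ⟨U, hU, hUr⟩ := hr
  refine ⟨fun x => T x + U x, hT.add hU, fun x => ?_⟩
  filter_upwards [Lp.coeFn_add (T x) (U x), hTq x, hUr x] with z h1 h2 h3
  rw [h1, Pi.add_apply, h2, h3]

lemma sub (hq : LpContinuous α σ q) (hr : LpContinuous α σ r) :
    LpContinuous α σ fun x z => q x z - r x z := by
  obtain ⟨T, hT, hTq⟩ := hq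
  obtain ⟨U, hU, hUr⟩ := hr
  refine ⟨fun x => T x - U x, hT.sub hU, fun x => ?_⟩
  filter_upwards [Lp.coeFn_sub (T x) (U x), hTq x, hUr x] with z h1 h2 h3
  rw [h1, Pi.sub_apply, h2, h3]

lemma const_mul (hq : LpContinuous α σ q) (c : ℝ) : LpContinuous α σ fun x z => c * q x z := by
  obtain ⟨T, hT, hTq⟩ := hq
  refine ⟨fun x => c • T x, hT.const_smul c, fun x => ?_⟩
  filter_upwards [Lp.coeFn_smul c (T x), hTq x] with z h1 h2
  rw [h1, Pi.smul_apply, h2, smul_eq_mul]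

lemma sum {ι : Type*} (s : Finset ι) {q : ι → X → S → ℝ} (hq : ∀ i, LpContinuous α σ (q i)) :
    LpContinuous α σ fun x z => ∑ i ∈ s, q i x z := by
  classical
  induction s using Finset.induction_on with
  | empty =>
    refine ⟨fun _ => 0, continuous_const, fun x => ?_⟩
    filter_upwards [Lp.coeFn_zero ℝ α σ] with z h
    rw [Finset.sum_empty]
    exact h
  | insert i s hi ih =>
    simp only [Finset.sum_insert hi]
    exact (hq i).add ih

lemma const [IsFiniteMeasure σ] (c : ℝ) : LpContinuous α σ fun (_ : X) (_ : S) => c :=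
  ⟨fun _ => (memLp_const c).toLp, continuous_const, fun _ => MemLp.coeFn_toLp _⟩

/-- Multiplication by a bounded function is a bounded operator on `L^α`; this admits the coordinates
of `z` as factors. -/
lemma bounded_mul {b : S → ℝ} (hb : Measurable b) {C : ℝ} (hC : ∀ z, |b z| ≤ C)
    (hq : LpContinuous α σ q) : LpContinuous α σ fun x z => b z * q x z := by
  obtain ⟨T, hT, hTq⟩ := hq
  have hle : ∀ (u : S → ℝ) (z : S), ‖b z * u z‖ ≤ C * ‖u z‖ := fun u z => by
    rw [norm_mul]
    exact mul_le_mul_of_nonneg_right (hC z) (norm_nonneg _)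
  have hmem : ∀ u : Lp ℝ α σ, MemLp (fun z => b z * u z) α σ := fun u =>
    (Lp.memLp u).of_le_mul (hb.aestronglyMeasurable.mul (Lp.aestronglyMeasurable u))
      (Filter.Eventually.of_forall (hle u))
  set B : Lp ℝ α σ →L[ℝ] Lp ℝ α σ := LinearMap.mkContinuous
    { toFun := fun u => (hmem u).toLp
      map_add' := fun u v => by
        refine Lp.ext ?_
        filter_upwards [(hmem (u + v)).coeFn_toLp, (hmem u).coeFn_toLp, (hmem v).coeFn_toLp,
          Lp.coeFn_add u v, Lp.coeFn_add (hmem u).toLp (hmem v).toLp] with z h1 h2 h3 h4 h5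
        rw [h1, h5, Pi.add_apply, h2, h3, h4, Pi.add_apply, mul_add]
      map_smul' := fun c u => by
        refine Lp.ext ?_
        filter_upwards [(hmem (c • u)).coeFn_toLp, (hmem u).coeFn_toLp, Lp.coeFn_smul c u,
          Lp.coeFn_smul c (hmem u).toLp] with z h1 h2 h3 h4
        simp only [RingHom.id_apply]
        rw [h1, h4, Pi.smul_apply, h2, h3, Pi.smul_apply, smul_eq_mul, smul_eq_mul]
        ring } C fun u => by
    refine Lp.norm_le_mul_norm_of_ae_le_mul ?_
    filter_upwards [(hmem u).coeFn_toLp] with z h1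
    simp only [LinearMap.coe_mk, AddHom.coe_mk]
    rw [h1]
    exact hle u z
  refine ⟨fun x => B (T x), B.continuous.comp hT, fun x => ?_⟩
  filter_upwards [(hmem (T x)).coeFn_toLp, hTq x] with z h1 h2
  rw [← h2]
  exact h1

lemma isClosed_ae_eq_zero (hq : LpContinuous α σ q) : IsClosed {x | q x =ᵐ[σ] 0} := by
  obtain ⟨T, hT, hTq⟩ := hq
  have : {x | q x =ᵐ[σ] 0} = {x | T x = 0} := by
    ext x
    simp only [Set.mem_ofPred_eq]
    rw [Lp.eq_zero_iff_ae_eq_zero]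
    exact ⟨fun h => (hTq x).trans h, fun h => (hTq x).symm.trans h⟩
  rw [this]
  exact isClosed_eq hT continuous_const

lemma integrable {q : X → S → ℝ} (hq : LpContinuous 1 σ q) (x : X) : Integrable (q x) σ := by
  obtain ⟨T, -, hTq⟩ := hq
  exact (L1.integrable_coeFn (T x)).congr (hTq x)

lemma continuous_integral {q : X → S → ℝ} (hq : LpContinuous 1 σ q) :
    Continuous fun x => ∫ z, q x z ∂σ := by
  obtain ⟨T, hT, hTq⟩ := hq
  refine (MeasureTheory.continuous_integral.comp hT).congr fun x => integral_congr_ae (hTq x)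

/-- The integral of the product is an `L²` inner product, which is jointly continuous. Hence
quadratic expressions pass to the limit in `W^{1,2}`. -/
lemma mul {q r : X → S → ℝ} (hq : LpContinuous 2 σ q) (hr : LpContinuous 2 σ r) :
    (∀ x, Integrable (fun z => q x z * r x z) σ) ∧
      Continuous fun x => ∫ z, q x z * r x z ∂σ := by
  obtain ⟨T, hT, hTq⟩ := hq
  obtain ⟨U, hU, hUr⟩ := hr
  have h : ∀ x, (fun z => inner ℝ (U x z) (T x z)) =ᵐ[σ] fun z => q x z * r x z := fun x => by
    filter_upwards [hTq x, hUr x] with z h1 h2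
    rw [h1, h2]
    simp
  refine ⟨fun x => (L2.integrable_inner (U x) (T x)).congr (h x), ?_⟩
  exact (hU.inner hT).congr fun x => integral_congr_ae (h x)

lemma sq {q : X → S → ℝ} (hq : LpContinuous 2 σ q) :
    (∀ x, Integrable (fun z => q x z ^ 2) σ) ∧ Continuous fun x => ∫ z, q x z ^ 2 ∂σ := by
  simp_rw [pow_two]
  exact hq.mul hq

lemma mean [IsFiniteMeasure σ] {q : X → S → ℝ} (hq : LpContinuous 2 σ q) :
    (∀ x, Integrable (q x) σ) ∧ Continuous fun x => ∫ z, q x z ∂σ := by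
  simpa using hq.mul (LpContinuous.const 1)

end LpContinuous

end LpContinuous

/-! ### Coordinates of a Sobolev element. -/

section SobolevCoordinates

variable {n : ℕ} {R : ℝ} {α : ℝ≥0∞} [Fact (1 ≤ α)] {X : Type*} [TopologicalSpace X]

lemma lpContinuous_fst {g : X → LpPair n R α} (hg : Continuous g) :
    LpContinuous α (unifSphere n R) fun x z => (g x).fst z :=
  ⟨fun x => (g x).fst, (WithLp.continuous_fst ..).comp hg, fun _ => Filter.EventuallyEq.rfl⟩

lemma lpContinuous_snd {g : X → LpPair n R α} (hg : Continuous g) (k : Fin n) :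
    LpContinuous α (unifSphere n R) fun x z => (g x).snd z k := by
  refine ⟨fun x => (EuclideanSpace.proj k : Eu n →L[ℝ] ℝ).compLpL α (unifSphere n R) (g x).snd,
    (ContinuousLinearMap.continuous _).comp ((WithLp.continuous_snd ..).comp hg), fun x => ?_⟩
  filter_upwards [ContinuousLinearMap.coeFn_compLpL (p := α) (μ := unifSphere n R)
    (EuclideanSpace.proj k : Eu n →L[ℝ] ℝ) (g x).snd] with z h
  rw [h]
  rfl

lemma abs_coord_le (i : Fin n) (z : Sph n R) : |(z : Eu n) i| ≤ R := by
  have h := PiLp.norm_apply_le (z : Eu n) i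
  rwa [norm_eq_of_mem_sphere z] at h

lemma LpContinuous.coord_mul {q : X → Sph n R → ℝ} (hq : LpContinuous α (unifSphere n R) q)
    (i : Fin n) : LpContinuous α (unifSphere n R) fun x z => (z : Eu n) i * q x z :=
  hq.bounded_mul (by fun_prop) (abs_coord_le i)

end SobolevCoordinates

/-! ### Radial extensions of smooth functions. -/

section SmoothFunctions

variable {n : ℕ} {R : ℝ}

lemma radialExt_coe (hR : 0 < R) (h : Sph n R → ℝ) (z : Sph n R) : radialExt h z = h z := by
  have hz : (R / ‖(z : Eu n)‖) • (z : Eu n) = z := sphereProj_of_norm_eq hR (norm_eq_of_mem_sphere z)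
  unfold radialExt
  rw [dif_pos (by rw [hz]; exact z.2)]
  congr 1
  exact Subtype.ext hz

lemma radialExt_smul (h : Sph n R → ℝ) (c : ℝ) (x : Eu n) (hc : 0 < c) :
    radialExt h (c • x) = radialExt h x := by
  have hx : (R / ‖c • x‖) • (c • x) = (R / ‖x‖) • x := sphereProj_smul hc x
  unfold radialExt
  by_cases hm : (R / ‖x‖) • x ∈ Metric.sphere (0 : Eu n) R
  · rw [dif_pos hm, dif_pos (hx ▸ hm)]
    exact congrArg h (Subtype.ext hx)
  · rw [dif_neg hm, dif_neg (hx ▸ hm)]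

lemma SmoothOnSphere.contDiffOn {h : Sph n R → ℝ} (hh : SmoothOnSphere h) :
    ContDiffOn ℝ 2 (radialExt h) {0}ᶜ :=
  by exact_mod_cast contDiffOn_infty.1 hh 2

lemma SmoothOnSphere.contDiffOn_one {h : Sph n R → ℝ} (hh : SmoothOnSphere h) :
    ContDiffOn ℝ 1 (radialExt h) {0}ᶜ :=
  hh.contDiffOn.of_le (by norm_num)

/-- The extension is constant along the ray through `x`; differentiate `c ↦ radialExt h (c • x)` at
`c = 1`. -/
lemma sum_coord_mul_partialDeriv_radialExt {h : Sph n R → ℝ} (hh : SmoothOnSphere h) {x : Eu n}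
    (hx : x ≠ 0) : ∑ j, x j * partialDeriv j (radialExt h) x = 0 := by
  rw [← fderiv_apply_self]
  have h1 : HasDerivAt (fun c : ℝ => radialExt h (c • x)) (fderiv ℝ (radialExt h) x x) 1 := by
    have h2 : HasDerivAt (fun c : ℝ => c • x) x 1 := by
      simpa using (hasDerivAt_id (1 : ℝ)).smul_const x
    have h3 := hasFDerivAt_of_contDiffOn hh.contDiffOn_one hx
    rw [← one_smul ℝ x] at h3
    simpa [Function.comp_def] using h3.comp_hasDerivAt (1 : ℝ) h2
  have h4 : (fun c : ℝ => radialExt h (c • x)) =ᶠ[nhds 1] fun _ => radialExt h x :=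
    (eventually_gt_nhds one_pos).mono fun c hc => radialExt_smul h c x hc
  exact h1.unique ((hasDerivAt_const _ _).congr_of_eventuallyEq h4)

lemma sphereGrad_apply (h : Sph n R → ℝ) (z : Sph n R) (k : Fin n) :
    sphereGrad h z k = partialDeriv k (radialExt h) z := by
  have h1 := EuclideanSpace.inner_single_right k (1 : ℝ) (sphereGrad h z)
  simp only [one_mul, conj_trivial] at h1
  rw [← h1, sphereGrad, gradient, InnerProductSpace.toDual_symm_apply]
  rfl

lemma norm_fderiv_radialExt_sq (h : Sph n R → ℝ) (z : Sph n R) :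
    ‖fderiv ℝ (radialExt h) z‖ ^ 2 = ∑ k, partialDeriv k (radialExt h) z ^ 2 := by
  have h1 : ‖sphereGrad h z‖ = ‖fderiv ℝ (radialExt h) z‖ := by
    rw [sphereGrad, gradient, LinearIsometryEquiv.norm_map]
  rw [← h1, EuclideanSpace.real_norm_sq_eq]
  simp_rw [sphereGrad_apply]

end SmoothFunctions

/-! ### Extension of the smooth identities by density. -/

section SobolevIdentities

variable {n : ℕ} {R : ℝ}

lemma ae_of_mem_smoothGraph (hR : 0 < R) {α : ℝ≥0∞} [Fact (1 ≤ α)] {p : LpPair n R α}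
    {h : Sph n R → ℝ} (h1 : p.fst =ᵐ[unifSphere n R] h) (h2 : p.snd =ᵐ[unifSphere n R] sphereGrad h) :
    ∀ᵐ z ∂unifSphere n R, p.fst z = radialExt h z ∧ ∀ k, p.snd z k = partialDeriv k (radialExt h) z := by
  filter_upwards [h1, h2] with z e1 e2
  exact ⟨by rw [e1, radialExt_coe hR], fun k => by rw [e2, sphereGrad_apply]⟩

/-- Tangentiality of the gradient holds for smooth functions by Euler's relation and is a closed
condition in `L^α`. -/
lemma sum_coord_mul_snd_eq_zero (hR : 0 < R) {α : ℝ≥0∞} [Fact (1 ≤ α)] {p : LpPair n R α}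
    (hp : p ∈ Sobolev n R α) : ∀ᵐ z : Sph n R ∂unifSphere n R, ∑ k, (z : Eu n) k * p.snd z k = 0 := by
  have hc : LpContinuous α (unifSphere n R)
      fun (p : LpPair n R α) (z : Sph n R) => ∑ k, (z : Eu n) k * p.snd z k :=
    .sum _ fun k => (lpContinuous_snd continuous_id k).coord_mul k
  refine closure_minimal (fun p hp => ?_) hc.isClosed_ae_eq_zero hp
  obtain ⟨h, hh, h1, h2⟩ := hp
  filter_upwards [ae_of_mem_smoothGraph hR h1 h2] with z hz
  simp only [hz.2]
  exact sum_coord_mul_partialDeriv_radialExt hh (ne_zero_of_mem_sphere hR z)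

variable [NeZero n]

/-- Both sides are continuous for the `W^{1,1}` norm; on smooth functions the radial derivative term
of the general formula vanishes. -/
lemma sobolev_one_integration_by_parts (hR : 0 < R) {p : LpPair n R 1} (hp : p ∈ Sobolev n R 1)
    (i : Fin n) : R ^ 2 * ∫ z, p.snd z i ∂unifSphere n R =
      ((n : ℝ) - 1) * ∫ z : Sph n R, (z : Eu n) i * p.fst z ∂unifSphere n R := by
  have c1 := (lpContinuous_snd (n := n) (R := R) (α := 1) continuous_id i).continuous_integral
  have c2 := ((lpContinuous_fst (n := n) (R := R) (α := 1) continuous_id).coord_mul i).continuous_integral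
  refine closure_minimal (fun p hp => ?_) (isClosed_eq (c1.const_mul (R ^ 2))
    (c2.const_mul ((n : ℝ) - 1))) hp
  obtain ⟨h, hh, h1, h2⟩ := hp
  have hae := ae_of_mem_smoothGraph hR h1 h2
  have hF := hh.contDiffOn_one
  have hFc := hF.continuousOn
  have hDc := continuousOn_partialDeriv hF i
  simp only [Set.mem_ofPred_eq, id]
  rw [integral_congr_ae (hae.mono fun z hz => hz.2 i),
    integral_congr_ae (hae.mono fun z hz => congrArg ((z : Eu n) i * ·) hz.1), ← sub_eq_zero,
    ← integral_const_mul, ← integral_const_mul, ← integral_sub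
      ((integrable_unifSphere hR hDc).const_mul _)
      ((integrable_unifSphere hR (g := fun z => z i * radialExt h z) (by fun_prop)).const_mul _),
    ← integral_partialDeriv_unifSphere hR hF i]
  congr 1 with z
  rw [sum_coord_mul_partialDeriv_radialExt hh (ne_zero_of_mem_sphere hR z)]
  ring

lemma sobolev_two_poincare (hR : 0 < R) (hn : 3 ≤ n) {p : LpPair n R 2} (hp : p ∈ Sobolev n R 2) :
    ∫ z, p.fst z ^ 2 ∂unifSphere n R - (∫ z, p.fst z ∂unifSphere n R) ^ 2 ≤
      ((n : ℝ) - 2)⁻¹ * R ^ 2 * ∑ k, ∫ z, p.snd z k ^ 2 ∂unifSphere n R := by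
  have := isProbabilityMeasure_unifSphere (n := n) hR
  have hc := lpContinuous_fst (n := n) (R := R) (α := 2) continuous_id
  have hc2 : Continuous fun p : LpPair n R 2 => ∑ k, ∫ z, p.snd z k ^ 2 ∂unifSphere n R :=
    continuous_finsetSum _ fun k _ =>
      (lpContinuous_snd (n := n) (R := R) (α := 2) continuous_id k).sq.2
  refine closure_minimal (fun p hp => ?_) (isClosed_le (hc.sq.2.sub (hc.mean.2.pow 2))
    (hc2.const_mul (((n : ℝ) - 2)⁻¹ * R ^ 2))) hp
  obtain ⟨h, hh, h1, h2⟩ := hp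
  have hae := ae_of_mem_smoothGraph hR h1 h2
  have hF := hh.contDiffOn_one
  have e1 : ∫ z, p.fst z ^ 2 ∂unifSphere n R = _ :=
    integral_congr_ae (hae.mono fun z hz => congrArg (· ^ 2) hz.1)
  have e2 : ∀ k, ∫ z, p.snd z k ^ 2 ∂unifSphere n R = _ := fun k =>
    integral_congr_ae (hae.mono fun z hz => congrArg (· ^ 2) (hz.2 k))
  have e3 := poincare_unifSphere hR hn hF (radialExt_smul h)
  simp only [Set.mem_ofPred_eq, id, Pi.sub_apply, Pi.pow_apply]
  rw [e1, integral_congr_ae (hae.mono fun z hz => hz.1)]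
  simp only [e2]
  refine e3.trans_eq ?_
  simp only [norm_fderiv_radialExt_sq]
  rw [integral_finsetSum _ fun k _ => integrable_unifSphere hR
    (g := fun z => partialDeriv k (radialExt h) z ^ 2) ((continuousOn_partialDeriv hF k).pow 2)]

lemma sobolev_two_second_order (hR : 0 < R) (hn : 3 ≤ n) {f : Fin n → LpPair n R 2}
    (hf : ∀ i, f i ∈ Sobolev n R 2) :
    ∫ z : Sph n R, ((n : ℝ) * (R ^ 2)⁻¹ * (∑ i, (z : Eu n) i * (f i).fst z) -
        ∑ i, (f i).snd z i) ^ 2 ∂unifSphere n R =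
      (n : ℝ) * (R ^ 2)⁻¹ * ∑ i, ∫ z, (f i).fst z ^ 2 ∂unifSphere n R +
      (n : ℝ) * ((n : ℝ) - 2)⁻¹ * ∑ i, ∑ j, ∫ z, (f i).snd z j * (f j).snd z i ∂unifSphere n R -
      2 * ((n : ℝ) - 2)⁻¹ * ∫ z, (∑ i, (f i).snd z i) ^ 2 ∂unifSphere n R := by
  have hv : ∀ i, LpContinuous 2 (unifSphere n R) fun (f : Fin n → LpPair n R 2) z => (f i).fst z :=
    fun i => lpContinuous_fst (continuous_apply i)
  have hg : ∀ i k, LpContinuous 2 (unifSphere n R)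
      fun (f : Fin n → LpPair n R 2) z => (f i).snd z k :=
    fun i k => lpContinuous_snd (continuous_apply i) k
  have hdiv := LpContinuous.sum Finset.univ fun i => hg i i
  have c1 := (((LpContinuous.sum Finset.univ fun i => (hv i).coord_mul i).const_mul
    ((n : ℝ) * (R ^ 2)⁻¹)).sub hdiv).sq.2
  have c2 := continuous_finsetSum Finset.univ fun i _ => (hv i).sq.2
  have c3 := continuous_finsetSum Finset.univ fun i _ => continuous_finsetSum Finset.univ
    fun j _ => ((hg i j).mul (hg j i)).2
  have c4 := hdiv.sq.2
  -- The identity couples the components, so all are approximated at once: the closure of a product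
  -- is the product of the closures.
  have hmem : f ∈ closure (Set.univ.pi fun _ : Fin n => smoothGraph n R 2) := by
    rw [closure_pi_set]
    exact fun i _ => hf i
  refine closure_minimal (fun f hf => ?_) (isClosed_eq c1
    (((c2.const_mul ((n : ℝ) * (R ^ 2)⁻¹)).add (c3.const_mul ((n : ℝ) * ((n : ℝ) - 2)⁻¹))).sub
      (c4.const_mul (2 * ((n : ℝ) - 2)⁻¹)))) hmem
  choose h hh h1 h2 using fun i => hf i (Set.mem_univ i)
  have hae := ae_all_iff.2 fun i => ae_of_mem_smoothGraph hR (h1 i) (h2 i)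
  have hF := fun i => (hh i).contDiffOn
  have hFc := fun i => (hF i).continuousOn
  have hDc := fun i k => continuousOn_partialDeriv (hh i).contDiffOn_one k
  have key := integral_second_order_unifSphere hR hn hF
    fun i x hx => sum_coord_mul_partialDeriv_radialExt (hh i) hx
  rw [integral_finsetSum _ fun i _ => integrable_unifSphere hR
      (g := fun z => radialExt (h i) z ^ 2) ((hFc i).pow 2),
    integral_finsetSum _ fun i _ => integrable_finsetSum _ fun j _ => integrable_unifSphere hR
      (g := fun z => partialDeriv j (radialExt (h i)) z * partialDeriv i (radialExt (h j)) z)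
      ((hDc i j).mul (hDc j i))] at key
  have e : ∀ i, ∫ z : Sph n R, ∑ j, partialDeriv j (radialExt (h i)) z *
      partialDeriv i (radialExt (h j)) z ∂unifSphere n R = ∑ j, ∫ z : Sph n R,
      partialDeriv j (radialExt (h i)) z * partialDeriv i (radialExt (h j)) z ∂unifSphere n R :=
    fun i => integral_finsetSum _ fun j _ => integrable_unifSphere hR
      (g := fun z => partialDeriv j (radialExt (h i)) z * partialDeriv i (radialExt (h j)) z)
      ((hDc i j).mul (hDc j i))
  simp only [e] at key
  simp only [Set.mem_ofPred_eq, Pi.add_apply, Pi.sub_apply]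
  convert key using 1
  · refine integral_congr_ae (hae.mono fun z hz => ?_)
    simp only [(hz _).1, (hz _).2]
  · congr 1
    · congr 1
      · congr 1
        exact Finset.sum_congr rfl fun i _ => integral_congr_ae (hae.mono fun z hz => by
          simp only [(hz _).1])
      · congr 1
        exact Finset.sum_congr rfl fun i _ => Finset.sum_congr rfl fun j _ =>
          integral_congr_ae (hae.mono fun z hz => by simp only [(hz _).2])
    · congr 1
      exact integral_congr_ae (hae.mono fun z hz => by simp only [(hz _).2])

end SobolevIdentities

/-! ### The projected gradient matrix. -/

section GradPerp

variable {n : ℕ} {R : ℝ} {α : ℝ≥0∞} [Fact (1 ≤ α)]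

lemma inner_val (f : Fin n → Sobolev n R α) (x : Sph n R) :
    inner ℝ (val f x) (x : Eu n) = ∑ i, (x : Eu n) i * (f i : LpPair n R α).fst x := by
  simp [val, PiLp.inner_apply]

/-- The projection subtracts from each row its component along `x`, which is zero almost everywhere
because gradients are tangential. -/
lemma ae_gradPerp_apply (hR : 0 < R) (f : Fin n → Sobolev n R α) :
    ∀ᵐ x ∂unifSphere n R, ∀ i k, gradPerp f x i k = (f i : LpPair n R α).snd x k := by
  filter_upwards [ae_all_iff.2 fun i => sum_coord_mul_snd_eq_zero hR (f i).2] with x hx i k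
  have h := hx i
  have h1 : ∑ j, (grad f x)ᵀ i j * Matrix.vecMulVec (x : Eu n) (x : Eu n) j k = 0 := by
    calc _ = (∑ j, (x : Eu n) j * (f i : LpPair n R α).snd x j) * (x : Eu n) k := by
          rw [Finset.sum_mul]
          refine Finset.sum_congr rfl fun j _ => ?_
          simp only [grad, Matrix.transpose_apply, Matrix.of_apply, Matrix.vecMulVec_apply]
          ring
      _ = 0 := by rw [h, zero_mul]
  rw [gradPerp, projPerp, Matrix.mul_sub, Matrix.mul_one, Matrix.mul_smul, Matrix.sub_apply,
    Matrix.smul_apply, Matrix.mul_apply, h1, smul_zero, sub_zero]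
  rfl

lemma trace_gradPerp {f : Fin n → Sobolev n R α} {x : Sph n R}
    (hx : ∀ i k, gradPerp f x i k = (f i : LpPair n R α).snd x k) :
    (gradPerp f x).trace = ∑ i, (f i : LpPair n R α).snd x i := by
  simp only [Matrix.trace, Matrix.diag, hx]

/-- Termwise `M i j * M j i ≤ (M i j² + M j i²) / 2`, and the two halves have equal sums. -/
lemma trace_sq_le_frobSq (M : Matrix (Fin n) (Fin n) ℝ) : (M ^ 2).trace ≤ frobSq M := by
  simp only [frobSq, pow_two M, Matrix.trace, Matrix.diag, Matrix.mul_apply]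
  have h1 : ∑ i, ∑ j, M i j * M j i ≤ ∑ i, ∑ j, (M i j ^ 2 / 2 + M j i ^ 2 / 2) :=
    Finset.sum_le_sum fun i _ => Finset.sum_le_sum fun j _ => by nlinarith [sq_nonneg (M i j - M j i)]
  refine h1.trans_eq ?_
  simp only [Finset.sum_add_distrib]
  rw [Finset.sum_comm (f := fun i j => M j i ^ 2 / 2)]
  simp only [← Finset.sum_add_distrib, add_halves]

end GradPerp

end SphereStein

/-! ### Assembly: transfer to the random vector `z`. -/

open SphereStein in
theorem mainTheorem3 (n : ℕ) (hn : 3 ≤ n) (R : ℝ) (hR : 0 < R)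
    {Ω : Type*} [MeasurableSpace Ω] (μ : Measure Ω) [IsProbabilityMeasure μ]
    (z : Ω → Sph n R) (hz : HasLaw z (unifSphere n R) μ) :
    -- first-order formula
    (∀ f : Fin n → Sobolev n R 1,
      Integrable (fun ω => inner ℝ (val f (z ω)) (z ω : Eu n)) μ ∧
      Integrable (fun ω => (gradPerp f (z ω)).trace) μ ∧
      ∫ ω, inner ℝ (val f (z ω)) (z ω : Eu n) ∂μ
        = ((n : ℝ) - 1)⁻¹ * R ^ 2 * ∫ ω, (gradPerp f (z ω)).trace ∂μ) ∧
    (∀ f : Fin n → Sobolev n R 2,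
      -- the expectations below are finite
      Integrable (fun ω => val f (z ω)) μ ∧
      Integrable (fun ω => ‖val f (z ω) - ∫ ω', val f (z ω') ∂μ‖ ^ 2) μ ∧
      Integrable (fun ω => ‖val f (z ω)‖ ^ 2) μ ∧
      Integrable (fun ω => frobSq (gradPerp f (z ω))) μ ∧
      Integrable (fun ω => ((gradPerp f (z ω)) ^ 2).trace) μ ∧
      Integrable (fun ω => (gradPerp f (z ω)).trace ^ 2) μ ∧
      Integrable (fun ω => ((n : ℝ) * (R ^ 2)⁻¹ * inner ℝ (val f (z ω)) (z ω : Eu n)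
        - (gradPerp f (z ω)).trace) ^ 2) μ ∧
      -- Poincaré inequality
      ∫ ω, ‖val f (z ω) - ∫ ω', val f (z ω') ∂μ‖ ^ 2 ∂μ
        ≤ ((n : ℝ) - 2)⁻¹ * R ^ 2 * ∫ ω, frobSq (gradPerp f (z ω)) ∂μ ∧
      -- second-order identity
      ∫ ω, ((n : ℝ) * (R ^ 2)⁻¹ * inner ℝ (val f (z ω)) (z ω : Eu n)
          - (gradPerp f (z ω)).trace) ^ 2 ∂μ
        = (n : ℝ) * (R ^ 2)⁻¹ * ∫ ω, ‖val f (z ω)‖ ^ 2 ∂μ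
          + (n : ℝ) * ((n : ℝ) - 2)⁻¹ * ∫ ω, ((gradPerp f (z ω)) ^ 2).trace ∂μ
          - 2 * ((n : ℝ) - 2)⁻¹ * ∫ ω, (gradPerp f (z ω)).trace ^ 2 ∂μ ∧
      -- second-order upper bound
      ∫ ω, ((n : ℝ) * (R ^ 2)⁻¹ * inner ℝ (val f (z ω)) (z ω : Eu n)
          - (gradPerp f (z ω)).trace) ^ 2 ∂μ
        ≤ (n : ℝ) * (R ^ 2)⁻¹ * ∫ ω, ‖val f (z ω)‖ ^ 2 ∂μ
          + (1 - 2 / (n : ℝ))⁻¹ * ∫ ω, frobSq (gradPerp f (z ω)) ∂μ) := by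
  have : NeZero n := ⟨by omega⟩
  have hσ := isProbabilityMeasure_unifSphere (n := n) hR
  have hn' : (3 : ℝ) ≤ n := by exact_mod_cast hn
  -- Moves integrability and expectations from `Ω` to the sphere, replacing the integrand by an
  -- almost everywhere equal one on the way; this is where `gradPerp` gives way to the bare
  -- gradient.
  have tr : ∀ {q r : Sph n R → ℝ}, r =ᵐ[unifSphere n R] q → Integrable q (unifSphere n R) →
      Integrable (fun ω => r (z ω)) μ ∧ ∫ ω, r (z ω) ∂μ = ∫ x, q x ∂unifSphere n R := by
    intro q r hqr hq
    have hr := hq.congr hqr.symm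
    refine ⟨(show Integrable r (μ.map z) by rwa [hz.map_eq]).comp_aemeasurable hz.aemeasurable, ?_⟩
    exact (hz.integral_comp hr.aestronglyMeasurable).trans (integral_congr_ae hqr)
  refine ⟨fun f => ?_, fun f => ?_⟩
  · have hi1 : ∀ i, Integrable (fun x : Sph n R => (x : Eu n) i * (f i : LpPair n R 1).fst x)
        (unifSphere n R) := fun i =>
      ((lpContinuous_fst (X := LpPair n R 1) continuous_id).coord_mul i).integrable (f i)
    have hi2 : ∀ i, Integrable (fun x : Sph n R => (f i : LpPair n R 1).snd x i)
        (unifSphere n R) := fun i =>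
      (lpContinuous_snd (X := LpPair n R 1) continuous_id i).integrable (f i)
    obtain ⟨t1, t2⟩ := tr (r := fun x => inner ℝ (val f x) (x : Eu n))
      (Filter.Eventually.of_forall fun x => inner_val f x)
      (integrable_finsetSum _ fun i _ => hi1 i)
    obtain ⟨t3, t4⟩ := tr (r := fun x => (gradPerp f x).trace)
      ((ae_gradPerp_apply hR f).mono fun x hx => trace_gradPerp hx)
      (integrable_finsetSum _ fun i _ => hi2 i)
    refine ⟨t1, t3, ?_⟩
    have hn1 : (n : ℝ) - 1 ≠ 0 := by linarith
    rw [t2, t4, integral_finsetSum _ fun i _ => hi1 i, integral_finsetSum _ fun i _ => hi2 i,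
      mul_assoc, Finset.mul_sum,
      Finset.sum_congr rfl fun i _ => sobolev_one_integration_by_parts hR (f i).2 i,
      ← Finset.mul_sum, inv_mul_cancel_left₀ hn1]
  · set F : Fin n → LpPair n R 2 := fun i => f i
    have hv : ∀ i, LpContinuous 2 (unifSphere n R) fun (f : Fin n → LpPair n R 2) x => (f i).fst x :=
      fun i => lpContinuous_fst (continuous_apply i)
    have hg : ∀ i k, LpContinuous 2 (unifSphere n R)
        fun (f : Fin n → LpPair n R 2) x => (f i).snd x k :=
      fun i k => lpContinuous_snd (continuous_apply i) k
    have hdiv := LpContinuous.sum Finset.univ fun i => hg i i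
    have hA := ae_gradPerp_apply hR f
    have iv : ∀ i, Integrable (fun x => (F i).fst x) (unifSphere n R) := fun i => (hv i).mean.1 F
    have iv2 : ∀ i, Integrable (fun x => (F i).fst x ^ 2) (unifSphere n R) := fun i => (hv i).sq.1 F
    have ig2 : ∀ i k, Integrable (fun x => (F i).snd x k ^ 2) (unifSphere n R) := fun i k =>
      (hg i k).sq.1 F
    have igg : ∀ i j, Integrable (fun x => (F i).snd x j * (F j).snd x i) (unifSphere n R) :=
      fun i j => ((hg i j).mul (hg j i)).1 F
    have hmean : Integrable (fun ω => val f (z ω)) μ :=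
      Integrable.of_eval_piLp fun i => (tr Filter.EventuallyEq.rfl (iv i)).1
    set m : Eu n := ∫ ω', val f (z ω') ∂μ with hm
    have hmi : ∀ i, m i = ∫ x, (F i).fst x ∂unifSphere n R := fun i => by
      rw [hm, eval_integral_piLp fun i => (tr Filter.EventuallyEq.rfl (iv i)).1]
      exact (tr Filter.EventuallyEq.rfl (iv i)).2
    have ivar : ∀ i, Integrable (fun x => ((F i).fst x - m i) ^ 2) (unifSphere n R) := fun i =>
      ((hv i).sub (.const (m i))).sq.1 F
    obtain ⟨a1, b1⟩ := tr (r := fun x => ‖val f x - m‖ ^ 2)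
      (q := fun x => ∑ i, ((F i).fst x - m i) ^ 2)
      (Filter.Eventually.of_forall fun x => EuclideanSpace.real_norm_sq_eq _)
      (integrable_finsetSum _ fun i _ => ivar i)
    obtain ⟨a2, b2⟩ := tr (r := fun x => ‖val f x‖ ^ 2) (q := fun x => ∑ i, (F i).fst x ^ 2)
      (Filter.Eventually.of_forall fun x => EuclideanSpace.real_norm_sq_eq _)
      (integrable_finsetSum _ fun i _ => iv2 i)
    obtain ⟨a3, b3⟩ := tr (r := fun x => frobSq (gradPerp f x))
      (q := fun x => ∑ i, ∑ k, (F i).snd x k ^ 2)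
      (hA.mono fun x hx => by simp only [frobSq, hx, F])
      (integrable_finsetSum _ fun i _ => integrable_finsetSum _ fun k _ => ig2 i k)
    obtain ⟨a4, b4⟩ := tr (r := fun x => ((gradPerp f x) ^ 2).trace)
      (q := fun x => ∑ i, ∑ j, (F i).snd x j * (F j).snd x i)
      (hA.mono fun x hx => by simp only [pow_two, Matrix.trace, Matrix.diag, Matrix.mul_apply, hx, F])
      (integrable_finsetSum _ fun i _ => integrable_finsetSum _ fun j _ => igg i j)
    obtain ⟨a5, b5⟩ := tr (r := fun x => (gradPerp f x).trace ^ 2)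
      (q := fun x => (∑ i, (F i).snd x i) ^ 2)
      (hA.mono fun x hx => by simp only [trace_gradPerp hx, F]) (hdiv.sq.1 F)
    obtain ⟨a6, b6⟩ := tr (r := fun x : Sph n R => ((n : ℝ) * (R ^ 2)⁻¹ * inner ℝ (val f x) (x : Eu n)
        - (gradPerp f x).trace) ^ 2)
      (q := fun x : Sph n R => ((n : ℝ) * (R ^ 2)⁻¹ * (∑ i, (x : Eu n) i * (F i).fst x) -
        ∑ i, (F i).snd x i) ^ 2)
      (hA.mono fun x hx => by simp only [trace_gradPerp hx, inner_val, F])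
      ((((LpContinuous.sum Finset.univ fun i => (hv i).coord_mul i).const_mul
        ((n : ℝ) * (R ^ 2)⁻¹)).sub hdiv).sq.1 F)
    have key := sobolev_two_second_order hR hn fun i => (f i).2
    have hfrob : ∫ x, ∑ i, ∑ k, (F i).snd x k ^ 2 ∂unifSphere n R =
        ∑ i, ∑ k, ∫ x, (F i).snd x k ^ 2 ∂unifSphere n R := by
      rw [integral_finsetSum _ fun i _ => integrable_finsetSum _ fun k _ => ig2 i k]
      exact Finset.sum_congr rfl fun i _ => integral_finsetSum _ fun k _ => ig2 i k
    have htr : ∫ x, ∑ i, ∑ j, (F i).snd x j * (F j).snd x i ∂unifSphere n R =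
        ∑ i, ∑ j, ∫ x, (F i).snd x j * (F j).snd x i ∂unifSphere n R := by
      rw [integral_finsetSum _ fun i _ => integrable_finsetSum _ fun j _ => igg i j]
      exact Finset.sum_congr rfl fun i _ => integral_finsetSum _ fun j _ => igg i j
    have hid : ∫ ω, ((n : ℝ) * (R ^ 2)⁻¹ * inner ℝ (val f (z ω)) (z ω : Eu n)
          - (gradPerp f (z ω)).trace) ^ 2 ∂μ
        = (n : ℝ) * (R ^ 2)⁻¹ * ∫ ω, ‖val f (z ω)‖ ^ 2 ∂μ
          + (n : ℝ) * ((n : ℝ) - 2)⁻¹ * ∫ ω, ((gradPerp f (z ω)) ^ 2).trace ∂μ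
          - 2 * ((n : ℝ) - 2)⁻¹ * ∫ ω, (gradPerp f (z ω)).trace ^ 2 ∂μ := by
      rw [b2, b4, b5, b6, htr, integral_finsetSum _ fun i _ => iv2 i]
      exact key
    have hn2 : 0 ≤ ((n : ℝ) - 2)⁻¹ := inv_nonneg.2 (by linarith)
    refine ⟨hmean, a1, a2, a3, a4, a5, a6, ?_, hid, ?_⟩
    · rw [b1, b3, hfrob, integral_finsetSum _ fun i _ => ivar i, Finset.mul_sum]
      refine Finset.sum_le_sum fun i _ => ?_
      have hvar : ∫ x, ((F i).fst x - m i) ^ 2 ∂unifSphere n R =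
          ∫ x, (F i).fst x ^ 2 ∂unifSphere n R - (∫ x, (F i).fst x ∂unifSphere n R) ^ 2 := by
        have e : ∀ x, ((F i).fst x - m i) ^ 2 = (F i).fst x ^ 2 - 2 * m i * (F i).fst x + m i ^ 2 :=
          fun x => by ring
        simp only [e]
        have i3 : Integrable (fun x => (F i).fst x ^ 2 - 2 * m i * (F i).fst x) (unifSphere n R) :=
          (iv2 i).sub ((iv i).const_mul _)
        rw [integral_add i3 (integrable_const _),
          integral_sub (iv2 i) ((iv i).const_mul _), integral_const_mul, ← hmi]
        simp
        ring
      rw [hvar]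
      exact sobolev_two_poincare hR hn (f i).2
    · have h1 : ∫ ω, ((gradPerp f (z ω)) ^ 2).trace ∂μ ≤ ∫ ω, frobSq (gradPerp f (z ω)) ∂μ :=
        integral_mono a4 a3 fun ω => trace_sq_le_frobSq _
      have h2 : 0 ≤ ∫ ω, (gradPerp f (z ω)).trace ^ 2 ∂μ := integral_nonneg fun ω => sq_nonneg _
      -- Thus the bound has the same coefficient as the `tr(M²)` term of the identity, and the
      -- remaining squared-trace term enters with a negative sign.
      have h3 : (1 - 2 / (n : ℝ))⁻¹ = (n : ℝ) * ((n : ℝ) - 2)⁻¹ := by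
        have : (n : ℝ) ≠ 0 := by linarith
        have : (n : ℝ) - 2 ≠ 0 := by linarith
        field_simp
      rw [hid, h3]
      have h4 := mul_le_mul_of_nonneg_left h1 (mul_nonneg n.cast_nonneg hn2)
      have h5 := mul_nonneg (mul_nonneg zero_le_two hn2) h2
      linarith
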